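/- Let $(M,g)$ be a globally hyperbolic spacetime: $M$ is a smooth (Hausdorff, second countable) manifold, $g$ a smooth, time-oriented Lorentzian metric of signature $(-,+,\dots,+)$, strong causality holds, and all causal diamonds $J^+(p)\cap J^-(q)$ are compact. For a smooth complex vector bundle $V\to M$ of finite constant rank, $\Gamma(M;V)$ is the space of smooth sections, $\Gamma_{\rm c}(M;V)$ the subspace of compactly supported ones, and $\Gamma_{\rm sc}(M;V)$ the subspace of space-compact ones, i.e. those with support in $J^+(C)\cup J^-(C)$ for some compact $C\subset M$. ${\rm Diff}(M;V,W)$ is the space of linear differential operators (with smooth coefficients, of some finite order) $\Gamma(M;V)\to\Gamma(M;W)$, and ${\rm Diff}(M;V)={\rm Diff}(M;V,V)$. A hermitian structure on $V$ is a smooth family of non-degenerate, not necessarily positive, hermitian forms on the fibres; $A^*$ denotes the formal adjoint of $A\in{\rm Diff}(M;V,W)$ with respect to the pairings $(u|v)_V=\int_M (u(x),v(x))_V\,d{\rm Vol}_g$. For $D\in{\rm Diff}(M;V)$, a retarded (advanced) propagator is a linear map $G^{+}$ ($G^-$) from $\Gamma_{\rm c}(M;V)$ to $\Gamma(M;V)$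 with $DG^\pm f=f$, $G^\pm Df=f$ and $\operatorname{supp}G^\pm f\subset J^\pm(\operatorname{supp} f)$ for all $f\in\Gamma_{\rm c}(M;V)$. $D$ is Green hyperbolic if both $D$ and $D^*$ have retarded and advanced propagators; those of $D$ are then unique, and $G_D=G_D^+-G_D^-$ is the causal propagator. Let $V_0,V_1$ be bundles with hermitian structures over $M$, and let $P\in{\rm Diff}(M;V_1)$ and $K,T\in{\rm Diff}(M;V_0,V_1)$ be such that (Hack–Schenkel hypotheses) $P^*=P$; $K\neq0$; $PK=0$; and the operators $R=K^*K$, $Q=K^*T\in{\rm Diff}(M;V_0)$ and $D=P+TK^*\in{\rm Diff}(M;V_1)$ are Green hyperbolic. For an operator $A$, write $A|_{\rm c}$, $A|_{\rm sc}$ for its restrictions to compactly supported and to space-compact smooth sections. Then all the quotients below make sense (each denominator is a subspace of its numerator), and $G_D$ induces maps $$\text{a)}\quad [G_D]:\ \frac{\operatorname{Ker}K^*|_{\rm c}}{\operatorname{Ran}P|_{\rm c}}\longrightarrow\frac{\operatorname{Ker}P|_{\rm sc}}{\operatorname{Ran}K|_{\rm sc}},$$ $$\text{b)}\quad [G_D]:\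 \frac{\operatorname{Ker}K^*|_{\rm c}}{\operatorname{Ran}P|_{\rm c}}\longrightarrow\frac{\operatorname{Ker}D|_{\rm sc}\cap\operatorname{Ker}K^*|_{\rm sc}}{\operatorname{Ran}G_DT|_{\rm c}},$$ which are both well defined, linear and bijective. -/

import Mathlib

open scoped Manifold ContDiff Bundle Topology ENNReal
open MeasureTheory Bundle

noncomputable section

/-! ### Complex vector bundles seen as real vector bundles -/

/-- A complex vector bundle is a real vector bundle. This is needed because smoothness of a bundle
over a real manifold is formulated with real scalars. -/
instance VectorBundle.complexToReal {M F : Type*} [TopologicalSpace M]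
    [NormedAddCommGroup F] [NormedSpace ℂ F] {V : M → Type*}
    [∀ x, AddCommGroup (V x)] [∀ x, Module ℂ (V x)] [∀ x, TopologicalSpace (V x)]
    [TopologicalSpace (TotalSpace F V)] [FiberBundle F V] [h : VectorBundle ℂ F V] :
    VectorBundle ℝ F V :=
  have lin : ∀ (e : Trivialization F (TotalSpace.proj : TotalSpace F V → M))
      [MemTrivializationAtlas e], e.IsLinear ℝ := fun e _ =>
    { linear := fun b hb =>
        { map_add := (e.linear ℂ hb).map_add
          map_smul := fun c x => by
            have := (e.linear ℂ hb).map_smul (c : ℂ) x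
            simpa using this } }
  { trivialization_linear' := lin
    continuousOn_coordChange' := fun e e' _ _ => by
      have h1 := h.continuousOn_coordChange' e e'
      have h2 :=
        (ContinuousLinearMap.restrictScalarsL ℂ F F ℝ ℝ).continuous.comp_continuousOn h1
      refine h2.congr fun b hb => ?_
      have := lin e
      have := lin e'
      ext v
      change (e.coordChangeL ℝ e' b) v = (e.coordChangeL ℂ e' b) v
      rw [Trivialization.coordChangeL_apply' e e' hb, Trivialization.coordChangeL_apply' e e' hb] }

namespace LinearGaugeTheory

/-! ### Lorentzian manifolds, causality and volume -/

section Lorentz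

variable (n : ℕ) (M : Type*) [TopologicalSpace M] [ChartedSpace (EuclideanSpace ℝ (Fin n)) M]
  [IsManifold (𝓡 n) ∞ M]

/-- A smooth Lorentzian metric of signature `(-,+,…,+)` together with a time orientation, given by
a continuous timelike vector field (which is future-directed by definition). -/
structure LorentzianStructure where
  /-- The metric. -/
  metric : ∀ x : M, TangentSpace (𝓡 n) x →L[ℝ] TangentSpace (𝓡 n) x →L[ℝ] ℝ
  symm : ∀ (x : M) (v w : TangentSpace (𝓡 n) x), metric x v w = metric x w v
  /-- At each point there is a timelike vector, and the metric is positive definite on its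
  orthogonal complement. -/
  signature : ∀ x : M, ∃ v : TangentSpace (𝓡 n) x, metric x v v < 0 ∧
    ∀ w : TangentSpace (𝓡 n) x, metric x v w = 0 → w ≠ 0 → 0 < metric x w w
  smooth : ContMDiff (𝓡 n)
    ((𝓡 n).prod 𝓘(ℝ, EuclideanSpace ℝ (Fin n) →L[ℝ] EuclideanSpace ℝ (Fin n) →L[ℝ] ℝ)) ∞
    (fun x : M => TotalSpace.mk' (EuclideanSpace ℝ (Fin n) →L[ℝ] EuclideanSpace ℝ (Fin n) →L[ℝ] ℝ)
      x (metric x))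
  /-- The vector field that fixes the time orientation. -/
  time : ∀ x : M, TangentSpace (𝓡 n) x
  time_timelike : ∀ x : M, metric x (time x) (time x) < 0
  time_continuous : Continuous fun x : M => (⟨x, time x⟩ : TangentBundle (𝓡 n) M)

variable {n M}

namespace LorentzianStructure

variable (g : LorentzianStructure n M)

/-- Future-directed causal (i.e. timelike or lightlike, in particular nonzero) tangent vectors. -/
def FutureCausal (x : M) (v : TangentSpace (𝓡 n) x) : Prop :=
  g.metric x v v ≤ 0 ∧ g.metric x (g.time x) v < 0

/-- `p` and `q` are joined by a future-directed causal `C¹` curve. -/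
def CausalArc (p q : M) : Prop :=
  ∃ c : ℝ → M, ContMDiffOn 𝓘(ℝ, ℝ) (𝓡 n) 1 c (Set.Icc 0 1) ∧ c 0 = p ∧ c 1 = q ∧
    ∀ t ∈ Set.Icc (0 : ℝ) 1,
      g.FutureCausal (c t) (mfderivWithin 𝓘(ℝ, ℝ) (𝓡 n) c (Set.Icc 0 1) t (1 : ℝ))

/-- The causal relation `p ≤ q`: either `p = q` or there is a future-directed causal piecewise
`C¹` curve from `p` to `q`. -/
def CausalLE (p q : M) : Prop := Relation.ReflTransGen g.CausalArc p q

/-- The causal future `J⁺(A)`. -/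
def JPlus (A : Set M) : Set M := {q | ∃ p ∈ A, g.CausalLE p q}

/-- The causal past `J⁻(A)`. -/
def JMinus (A : Set M) : Set M := {q | ∃ p ∈ A, g.CausalLE q p}

/-- Global hyperbolicity: strong causality (every neighbourhood `U` of a point contains a
neighbourhood `W` of it such that causal curves with end points in `W` stay in `U`), and
compactness of all causal diamonds. -/
def GloballyHyperbolic : Prop :=
  (∀ p : M, ∀ U ∈ 𝓝 p, ∃ W ∈ 𝓝 p, W ⊆ U ∧
    ∀ a ∈ W, ∀ b ∈ W, ∀ x, g.CausalLE a x → g.CausalLE x b → x ∈ U) ∧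
  ∀ p q : M, IsCompact (g.JPlus {p} ∩ g.JMinus {q})

/-- The Gram matrix of the metric in the coordinates `extChartAt (𝓡 n) x₀`, at the point with
coordinates `y`. -/
def gram (x₀ : M) (y : EuclideanSpace ℝ (Fin n)) : Matrix (Fin n) (Fin n) ℝ :=
  let d := mfderiv (𝓡 n) (𝓡 n) (extChartAt (𝓡 n) x₀).symm y
  Matrix.of fun i j => g.metric ((extChartAt (𝓡 n) x₀).symm y)
    (d (EuclideanSpace.single i (1 : ℝ))) (d (EuclideanSpace.single j (1 : ℝ)))

variable [MeasurableSpace M]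

/-- The measure `√|det g| dy` of the chart domain around `x₀`, as a measure on `M`. -/
def localVolume (x₀ : M) : Measure M :=
  Measure.map (extChartAt (𝓡 n) x₀).symm
    ((volume.restrict (extChartAt (𝓡 n) x₀).target).withDensity
      fun y => ENNReal.ofReal (Real.sqrt |(g.gram x₀ y).det|))

/-- The volume measure `dVol_g`. The local volume measures agree on overlaps of chart domains, and
their supremum is the unique Borel measure that restricts to each of them. -/
def volumeMeasure : Measure M := ⨆ x₀ : M, g.localVolume x₀

end LorentzianStructure

end Lorentz

/-! ### Sections of vector bundles -/

section Sections

variable (n : ℕ) {M : Type*} [TopologicalSpace M] [ChartedSpace (EuclideanSpace ℝ (Fin n)) M]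
  (F : Type*) [NormedAddCommGroup F] [NormedSpace ℂ F] (V : M → Type*)
  [∀ x, AddCommGroup (V x)] [∀ x, Module ℂ (V x)] [∀ x, TopologicalSpace (V x)]
  [TopologicalSpace (TotalSpace F V)] [FiberBundle F V] [VectorBundle ℂ F V]

/-- The complex vector space `Γ(M;V)` of smooth sections of `V`. -/
def Sec : Submodule ℂ (∀ x, V x) where
  carrier := {s | ContMDiff (𝓡 n) ((𝓡 n).prod 𝓘(ℝ, F)) ∞ fun x => TotalSpace.mk' F x (s x)}
  add_mem' hs ht := ContMDiff.add_section hs ht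
  zero_mem' := contMDiff_zeroSection ℝ V
  smul_mem' c s hs := by
    intro x₀
    have h := hs x₀
    rw [contMDiffAt_section] at h ⊢
    have hc : ContMDiff 𝓘(ℝ, F) 𝓘(ℝ, F) ∞ (fun v : F => c • v) := (contDiff_const_smul c).contMDiff
    refine (hc.contMDiffAt.comp x₀ h).congr_of_eventuallyEq ?_
    filter_upwards [(trivializationAt F V x₀).open_baseSet.mem_nhds
      (mem_baseSet_trivializationAt F V x₀)] with y hy
    exact ((trivializationAt F V x₀).linear ℂ hy).map_smul c (s y)

variable {n F V}

/-- The support of a section. -/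
def secSupp (u : Sec n F V) : Set M := closure {x | u.1 x ≠ 0}

theorem secSupp_add (u v : Sec n F V) : secSupp (u + v) ⊆ secSupp u ∪ secSupp v := by
  unfold secSupp
  rw [← closure_union]
  refine closure_mono fun x hx => ?_
  by_contra h
  simp only [Set.mem_union, Set.mem_ofPred_eq, not_or, not_not] at h
  exact hx (by change u.1 x + v.1 x = 0; rw [h.1, h.2, add_zero])

theorem secSupp_zero : secSupp (0 : Sec n F V) = ∅ := by
  simp [secSupp]

theorem secSupp_smul (c : ℂ) (u : Sec n F V) : secSupp (c • u) ⊆ secSupp u := by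
  refine closure_mono fun x hx h => hx ?_
  change c • u.1 x = 0
  rw [h, smul_zero]

variable (n F V)

/-- The space `Γ_c(M;V)` of smooth sections with compact support. -/
def SecC : Submodule ℂ (Sec n F V) where
  carrier := {u | IsCompact (secSupp u)}
  add_mem' {u v} hu hv :=
    (IsCompact.union hu hv).of_isClosed_subset isClosed_closure (secSupp_add u v)
  zero_mem' := by
    change IsCompact (secSupp (0 : Sec n F V))
    rw [secSupp_zero]
    exact isCompact_empty
  smul_mem' c u hu := IsCompact.of_isClosed_subset hu isClosed_closure (secSupp_smul c u)

variable [IsManifold (𝓡 n) ∞ M] {n}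

/-- The space `Γ_sc(M;V)` of smooth sections with space-compact support: the support is contained
in `J⁺(K) ∪ J⁻(K)` for some compact set `K`. -/
def SecSC (g : LorentzianStructure n M) : Submodule ℂ (Sec n F V) where
  carrier := {u | ∃ K : Set M, IsCompact K ∧ secSupp u ⊆ g.JPlus K ∪ g.JMinus K}
  add_mem' {u v} hu hv := by
    obtain ⟨K, hK, hu⟩ := hu
    obtain ⟨L, hL, hv⟩ := hv
    refine ⟨K ∪ L, hK.union hL, fun x hx => ?_⟩
    rcases secSupp_add u v hx with h | h
    · rcases hu h with ⟨p, hp, h⟩ | ⟨p, hp, h⟩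
      · exact Or.inl ⟨p, Or.inl hp, h⟩
      · exact Or.inr ⟨p, Or.inl hp, h⟩
    · rcases hv h with ⟨p, hp, h⟩ | ⟨p, hp, h⟩
      · exact Or.inl ⟨p, Or.inr hp, h⟩
      · exact Or.inr ⟨p, Or.inr hp, h⟩
  zero_mem' := ⟨∅, isCompact_empty, by rw [secSupp_zero]; exact Set.empty_subset _⟩
  smul_mem' c u hu := by
    obtain ⟨K, hK, hu⟩ := hu
    exact ⟨K, hK, (secSupp_smul c u).trans hu⟩

variable (n)

/-- A hermitian structure on `V`: a smooth family of non-degenerate hermitian forms on the fibres,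
not necessarily positive, antilinear in the first argument. -/
structure HermitianStructure where
  /-- The form on the fibre at `x`. -/
  form : ∀ x : M, V x →ₗ⋆[ℂ] V x →ₗ[ℂ] ℂ
  symm : ∀ (x : M) (v w : V x), (starRingEnd ℂ) (form x v w) = form x w v
  nondegenerate : ∀ (x : M) (v : V x), (∀ w : V x, form x v w = 0) → v = 0
  smooth : ∀ u v : Sec n F V,
    ContMDiff (𝓡 n) 𝓘(ℝ, ℂ) ∞ fun x => form x (u.1 x) (v.1 x)

variable {n F V}

/-- The pairing `(u|v)_V = ∫ (u(x), v(x))_V dVol_g`. -/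
def pairing [MeasurableSpace M] (g : LorentzianStructure n M) (h : HermitianStructure n F V)
    (u v : Sec n F V) : ℂ :=
  ∫ x, h.form x (u.1 x) (v.1 x) ∂g.volumeMeasure

/-- The `m`-jet of the section `u` vanishes at `x`: in the preferred chart and trivialization
around `x`, all derivatives up to order `m` vanish at `x`. -/
def JetVanishes (m : ℕ) (u : Sec n F V) (x : M) : Prop :=
  ∀ k ≤ m, iteratedFDeriv ℝ k
    (fun y => (trivializationAt F V x ⟨(extChartAt (𝓡 n) x).symm y,
      u.1 ((extChartAt (𝓡 n) x).symm y)⟩).2) (extChartAt (𝓡 n) x x) = 0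

end Sections

/-! ### Differential operators, formal adjoints and propagators -/

section Operators

variable {n : ℕ} {M : Type*} [TopologicalSpace M] [ChartedSpace (EuclideanSpace ℝ (Fin n)) M]
  [IsManifold (𝓡 n) ∞ M]
  {F : Type*} [NormedAddCommGroup F] [NormedSpace ℂ F] {V : M → Type*}
  [∀ x, AddCommGroup (V x)] [∀ x, Module ℂ (V x)] [∀ x, TopologicalSpace (V x)]
  [TopologicalSpace (TotalSpace F V)] [FiberBundle F V] [VectorBundle ℂ F V]
  {F' : Type*} [NormedAddCommGroup F'] [NormedSpace ℂ F'] {W : M → Type*}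
  [∀ x, AddCommGroup (W x)] [∀ x, Module ℂ (W x)] [∀ x, TopologicalSpace (W x)]
  [TopologicalSpace (TotalSpace F' W)] [FiberBundle F' W] [VectorBundle ℂ F' W]

/-- `A ∈ Diff(M;V,W)`: for some order `m`, the value of `A u` at any point depends only on the
`m`-jet of `u` at this point. -/
def IsDiffOp (A : Sec n F V →ₗ[ℂ] Sec n F' W) : Prop :=
  ∃ m : ℕ, ∀ (u : Sec n F V) (x : M), JetVanishes m u x → (A u).1 x = 0

variable [MeasurableSpace M] (g : LorentzianStructure n M)

/-- The differential operator `B` is a formal adjoint of `A`: `(Au|v)_W = (u|Bv)_V` for all compactly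
supported smooth sections `u`, `v`. -/
def IsFormalAdjoint (h : HermitianStructure n F V) (k : HermitianStructure n F' W)
    (A : Sec n F V →ₗ[ℂ] Sec n F' W) (B : Sec n F' W →ₗ[ℂ] Sec n F V) : Prop :=
  IsDiffOp B ∧ ∀ u ∈ SecC n F V, ∀ v ∈ SecC n F' W,
    pairing g k (A u) v = pairing g h u (B v)

open Classical in
/-- The formal adjoint `A*` (every differential operator has exactly one). -/
def formalAdjoint (h : HermitianStructure n F V) (k : HermitianStructure n F' W)
    (A : Sec n F V →ₗ[ℂ] Sec n F' W) : Sec n F' W →ₗ[ℂ] Sec n F V :=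
  if hA : ∃ B, IsFormalAdjoint g h k A B then hA.choose else 0

/-- `G` is a retarded propagator of `D`: `D G f = f`, `G D f = f` and `supp (G f) ⊆ J⁺(supp f)` for
compactly supported `f`. -/
def IsRetarded (D : Sec n F V →ₗ[ℂ] Sec n F V) (G : SecC n F V →ₗ[ℂ] Sec n F V) : Prop :=
  (∀ f : SecC n F V, D (G f) = f) ∧
  (∀ f f' : SecC n F V, D f = f' → G f' = f) ∧
  ∀ f : SecC n F V, secSupp (G f) ⊆ g.JPlus (secSupp f.1)

/-- `G` is an advanced propagator of `D`: `D G f = f`, `G D f = f` and `supp (G f) ⊆ J⁻(supp f)` for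
compactly supported `f`. -/
def IsAdvanced (D : Sec n F V →ₗ[ℂ] Sec n F V) (G : SecC n F V →ₗ[ℂ] Sec n F V) : Prop :=
  (∀ f : SecC n F V, D (G f) = f) ∧
  (∀ f f' : SecC n F V, D f = f' → G f' = f) ∧
  ∀ f : SecC n F V, secSupp (G f) ⊆ g.JMinus (secSupp f.1)

/-- `D` is Green hyperbolic: `D` and `D*` have retarded and advanced propagators. -/
def GreenHyperbolic (h : HermitianStructure n F V) (D : Sec n F V →ₗ[ℂ] Sec n F V) : Prop :=
  (∃ G, IsRetarded g D G) ∧ (∃ G, IsAdvanced g D G) ∧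
  (∃ G, IsRetarded g (formalAdjoint g h h D) G) ∧ ∃ G, IsAdvanced g (formalAdjoint g h h D) G

open Classical in
/-- The retarded propagator `G⁺_D` (it is unique if `D` is Green hyperbolic). -/
def retarded (D : Sec n F V →ₗ[ℂ] Sec n F V) : SecC n F V →ₗ[ℂ] Sec n F V :=
  if hD : ∃ G, IsRetarded g D G then hD.choose else 0

open Classical in
/-- The advanced propagator `G⁻_D` (it is unique if `D` is Green hyperbolic). -/
def advanced (D : Sec n F V →ₗ[ℂ] Sec n F V) : SecC n F V →ₗ[ℂ] Sec n F V :=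
  if hD : ∃ G, IsAdvanced g D G then hD.choose else 0

/-- The causal propagator `G_D = G⁺_D - G⁻_D`. -/
def causalPropagator (D : Sec n F V →ₗ[ℂ] Sec n F V) : SecC n F V →ₗ[ℂ] Sec n F V :=
  retarded g D - advanced g D

/-- The Hack–Schenkel hypotheses on `P ∈ Diff(M;V₁)` and `K, T ∈ Diff(M;V₀,V₁)`, where `W` is `V₁`
and `V` is `V₀`. -/
structure HackSchenkel (h₀ : HermitianStructure n F V) (h₁ : HermitianStructure n F' W)
    (P : Sec n F' W →ₗ[ℂ] Sec n F' W) (K T : Sec n F V →ₗ[ℂ] Sec n F' W) : Prop where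
  diffOp_P : IsDiffOp P
  selfAdjoint_P : formalAdjoint g h₁ h₁ P = P
  diffOp_K : IsDiffOp K
  K_ne_zero : K ≠ 0
  P_comp_K : P ∘ₗ K = 0
  green_R : GreenHyperbolic g h₀ (formalAdjoint g h₀ h₁ K ∘ₗ K)
  diffOp_T : IsDiffOp T
  green_D : GreenHyperbolic g h₁ (P + T ∘ₗ formalAdjoint g h₀ h₁ K)
  green_Q : GreenHyperbolic g h₀ (formalAdjoint g h₀ h₁ K ∘ₗ T)

end Operators

/-! ### Maps induced on quotients -/

/-- The linear map `G`, defined on `S`, induces a well-defined linear map `E₁ / F₁ → E₂ / F₂`,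
and this map is bijective. -/
def InducesBijection {X Y : Type*} [AddCommGroup X] [Module ℂ X] [AddCommGroup Y] [Module ℂ Y]
    {S : Submodule ℂ X} (G : S →ₗ[ℂ] Y) (E₁ F₁ : Submodule ℂ X) (E₂ F₂ : Submodule ℂ Y) : Prop :=
  F₁ ≤ E₁ ∧ F₂ ≤ E₂ ∧ ∃ hS : E₁ ≤ S,
    ∃ φ : (E₁ ⧸ F₁.submoduleOf E₁) →ₗ[ℂ] (E₂ ⧸ F₂.submoduleOf E₂),
      (∀ u : E₁, ∃ hu : G (Submodule.inclusion hS u) ∈ E₂,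
        φ (Submodule.Quotient.mk u) =
          Submodule.Quotient.mk ⟨G (Submodule.inclusion hS u), hu⟩) ∧
      Function.Bijective φ

end LinearGaugeTheory

end

open LinearGaugeTheory

namespace LinearGaugeTheory

/-! ### Tangent vectors in coordinates -/

section Charts

variable {n : ℕ} {M : Type*} [TopologicalSpace M] [ChartedSpace (EuclideanSpace ℝ (Fin n)) M]
  [IsManifold (𝓡 n) ∞ M]

/-! Write G for causal propagators, with D = P + TK*, R = K*K and Q = K*T. Taking adjoints in PK = 0
gives K*P = 0 (`formalAdjoint_comp_eq_zero`), hence K*D = QK* and DK = TR. Uniqueness of solutions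
with one-sided causal support turns these into K*G_D = G_Q K* and K G_R = G_D T on compactly
supported sections (`map_causalPropagator`). The other tool is the exactness, for each of R, Q and
D, of the parts that are needed of 0 → Γ_c → Γ_c → Γ_sc → Γ_sc → 0, with maps D, G_D, D
(`mapC_injective`, `exists_mapC_eq_of_causalPropagator_eq_zero`, `exists_causalPropagator_eq`,
`exists_preimage_secSC`).

Injectivity: let K*f = 0 and G_D f = G_D Tq. Then f - Tq = Dk = Pk + TK*k with k compactly
supported. Applying K* gives Q(K*k) = Q(-q), so K*k = -q and f = Pk. In a), G_D f = Kh implies Rh =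
0, so h = G_R q and Kh = G_D Tq, which is the same situation.

Surjectivity: if Du = 0 and K*u = 0, then u = G_D f with G_Q K*f = 0, so K*f = Qq, and f - Tq
represents u modulo Ran G_D T. In a), solving Rh = K*v first gives v - Kh in Ker D ∩ Ker K*.

The analysis behind exactness uses only locality of the operators, cutoff functions, and the fact
that J⁺(C) ∩ J⁻(C') is compact for compact C, C'. Uniqueness comes from pairing with the propagators
of the adjoint, so the pairing must be non-degenerate. This needs a locally finite volume measure
that is positive on open sets. -/

theorem LorentzianStructure.continuousOn_metric (g : LorentzianStructure n M) {X : Type*}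
    [TopologicalSpace X] {b : X → M} {v w : ∀ x, TangentSpace (𝓡 n) (b x)} {s : Set X}
    (hv : ContinuousOn (fun x => (⟨b x, v x⟩ : TangentBundle (𝓡 n) M)) s)
    (hw : ContinuousOn (fun x => (⟨b x, w x⟩ : TangentBundle (𝓡 n) M)) s) :
    ContinuousOn (fun x => g.metric (b x) (v x) (w x)) s := by
  intro x hx
  have hb : ContinuousWithinAt b s x := by
    have := hv x hx
    rw [FiberBundle.continuousWithinAt_totalSpace] at this
    exact this.1
  have key : ContinuousWithinAt (fun m ↦ TotalSpace.mk' ℝ (E := Bundle.Trivial M ℝ) (b m)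
      (g.metric (b m) (v m) (w m))) s x :=
    (g.smooth.continuous.continuousAt.comp_continuousWithinAt hb).clm_bundle_apply₂
      (F₁ := EuclideanSpace ℝ (Fin n)) (F₂ := EuclideanSpace ℝ (Fin n)) (hv x hx) (hw x hx)
  rw [FiberBundle.continuousWithinAt_totalSpace] at key
  exact key.2

/-- The tangent vector with given coefficients in a chart depends continuously on the coordinates of
the base point and on the coefficients. -/
theorem continuousOn_chartVector (x₀ : M) :
    ContinuousOn (fun p : EuclideanSpace ℝ (Fin n) × EuclideanSpace ℝ (Fin n) =>
      (⟨(extChartAt (𝓡 n) x₀).symm p.1,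
        mfderiv (𝓡 n) (𝓡 n) (extChartAt (𝓡 n) x₀).symm p.1 p.2⟩ : TangentBundle (𝓡 n) M))
      ((extChartAt (𝓡 n) x₀).target ×ˢ Set.univ) := by
  have h1 : ContMDiffOn (𝓡 n) (𝓡 n) ∞ (extChartAt (𝓡 n) x₀).symm (extChartAt (𝓡 n) x₀).target :=
    contMDiffOn_extChartAt_symm x₀
  have ho := isOpen_extChartAt_target (I := 𝓡 n) x₀
  have h2 := h1.continuousOn_tangentMapWithin (by simp) ho.uniqueMDiffOn
  have h3 := h2.comp (s := (extChartAt (𝓡 n) x₀).target ×ˢ Set.univ)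
    (tangentBundleModelSpaceHomeomorph (𝓡 n)).symm.continuous.continuousOn
    (fun p hp => hp.1)
  refine h3.congr fun p hp => ?_
  have e := mfderivWithin_of_isOpen (I := 𝓡 n) (I' := 𝓡 n)
    (f := (extChartAt (𝓡 n) x₀).symm) ho hp.1
  exact congrArg (fun L : EuclideanSpace ℝ (Fin n) →L[ℝ] EuclideanSpace ℝ (Fin n) =>
    (⟨(extChartAt (𝓡 n) x₀).symm p.1, L p.2⟩ : TangentBundle (𝓡 n) M)) e.symm

/-- The tangent vector with coefficients `w` at the point with coordinates `y`. -/
noncomputable def chartVector (x₀ : M) (y w : EuclideanSpace ℝ (Fin n)) :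
    TangentSpace (𝓡 n) ((extChartAt (𝓡 n) x₀).symm y) :=
  mfderiv (𝓡 n) (𝓡 n) (extChartAt (𝓡 n) x₀).symm y w

omit [IsManifold (𝓡 n) ∞ M] in
theorem chartVector_smul (x₀ : M) (y : EuclideanSpace ℝ (Fin n)) (c : ℝ)
    (w : EuclideanSpace ℝ (Fin n)) : chartVector x₀ y (c • w) = c • chartVector x₀ y w :=
  (mfderiv (𝓡 n) (𝓡 n) (extChartAt (𝓡 n) x₀).symm y).map_smul c w

omit [IsManifold (𝓡 n) ∞ M] in
theorem chartVector_add (x₀ : M) (y v w : EuclideanSpace ℝ (Fin n)) :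
    chartVector x₀ y (v + w) = chartVector x₀ y v + chartVector x₀ y w :=
  (mfderiv (𝓡 n) (𝓡 n) (extChartAt (𝓡 n) x₀).symm y).map_add v w

theorem mdifferentiableAt_extChartAt_symm_of_boundaryless (x₀ : M) {y : EuclideanSpace ℝ (Fin n)}
    (hy : y ∈ (extChartAt (𝓡 n) x₀).target) :
    MDifferentiableAt (𝓡 n) (𝓡 n) (extChartAt (𝓡 n) x₀).symm y :=
  (((contMDiffOn_extChartAt_symm (n := ∞) x₀).mdifferentiableOn (by simp)) y hy).mdifferentiableAt
    ((isOpen_extChartAt_target (I := 𝓡 n) x₀).mem_nhds hy)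

theorem chartVector_bijective (x₀ : M) {y : EuclideanSpace ℝ (Fin n)}
    (hy : y ∈ (extChartAt (𝓡 n) x₀).target) : Function.Bijective (chartVector x₀ y) := by
  have h := isInvertible_mfderivWithin_extChartAt_symm (I := 𝓡 n) hy
  rw [modelWithCornersSelf_coe, Set.range_id, mfderivWithin_univ] at h
  exact h.bijective

end Charts

/-! ### Short causal curves in charts -/

namespace LorentzianStructure

variable {n : ℕ} {M : Type*} [TopologicalSpace M] [ChartedSpace (EuclideanSpace ℝ (Fin n)) M]
  [IsManifold (𝓡 n) ∞ M] (g : LorentzianStructure n M)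

/-- The metric in the coordinates `extChartAt (𝓡 n) x₀`. -/
noncomputable def coordMetric (x₀ : M) (y v w : EuclideanSpace ℝ (Fin n)) : ℝ :=
  g.metric ((extChartAt (𝓡 n) x₀).symm y) (chartVector x₀ y v) (chartVector x₀ y w)

theorem continuousOn_coordMetric (x₀ : M) :
    ContinuousOn (fun p : EuclideanSpace ℝ (Fin n) × EuclideanSpace ℝ (Fin n) ×
      EuclideanSpace ℝ (Fin n) => g.coordMetric x₀ p.1 p.2.1 p.2.2)
      ((extChartAt (𝓡 n) x₀).target ×ˢ Set.univ) :=
  g.continuousOn_metric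
    ((continuousOn_chartVector x₀).comp (f := fun p : EuclideanSpace ℝ (Fin n) ×
      EuclideanSpace ℝ (Fin n) × EuclideanSpace ℝ (Fin n) => (p.1, p.2.1))
      (by fun_prop) (fun p hp => ⟨hp.1, trivial⟩))
    ((continuousOn_chartVector x₀).comp (f := fun p : EuclideanSpace ℝ (Fin n) ×
      EuclideanSpace ℝ (Fin n) × EuclideanSpace ℝ (Fin n) => (p.1, p.2.2))
      (by fun_prop) (fun p hp => ⟨hp.1, trivial⟩))

theorem continuousOn_coordTime (x₀ : M) :
    ContinuousOn (fun p : EuclideanSpace ℝ (Fin n) × EuclideanSpace ℝ (Fin n) =>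
      g.metric ((extChartAt (𝓡 n) x₀).symm p.1) (g.time _) (chartVector x₀ p.1 p.2))
      ((extChartAt (𝓡 n) x₀).target ×ˢ Set.univ) :=
  g.continuousOn_metric
    (g.time_continuous.comp_continuousOn ((continuousOn_extChartAt_symm x₀).comp
      continuousOn_fst (fun _ hp => hp.1)))
    (continuousOn_chartVector x₀)

variable {g} in
theorem FutureCausal.smul {x : M} {v : TangentSpace (𝓡 n) x} (h : g.FutureCausal x v) {c : ℝ}
    (hc : 0 < c) : g.FutureCausal x (c • v) := by
  obtain ⟨h1, h2⟩ := h
  refine ⟨?_, ?_⟩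
  · rw [map_smul, map_smul, smul_apply, smul_eq_mul, smul_eq_mul]
    have := mul_nonneg hc.le hc.le
    nlinarith
  · rw [map_smul, smul_eq_mul]
    exact mul_neg_of_pos_of_neg hc h2

/-- Being timelike and future-directed is an open condition on base point and coefficients together,
and the time-orienting vector satisfies it at `y₀`. -/
theorem exists_futureCausal_ball (x₀ : M) {y₀ : EuclideanSpace ℝ (Fin n)}
    (hy₀ : y₀ ∈ (extChartAt (𝓡 n) x₀).target) :
    ∃ T₀ : EuclideanSpace ℝ (Fin n), ∃ r > 0, Metric.ball y₀ r ⊆ (extChartAt (𝓡 n) x₀).target ∧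
      ∀ y ∈ Metric.ball y₀ r, ∀ w ∈ Metric.ball T₀ r, g.FutureCausal _ (chartVector x₀ y w) := by
  obtain ⟨T₀, hT₀⟩ := (chartVector_bijective x₀ hy₀).2 (g.time _)
  have hopen : IsOpen ((extChartAt (𝓡 n) x₀).target ×ˢ
      (Set.univ : Set (EuclideanSpace ℝ (Fin n)))) :=
    (isOpen_extChartAt_target (I := 𝓡 n) x₀).prod isOpen_univ
  have hA : ContinuousOn (fun p : EuclideanSpace ℝ (Fin n) × EuclideanSpace ℝ (Fin n) =>
      g.coordMetric x₀ p.1 p.2 p.2) ((extChartAt (𝓡 n) x₀).target ×ˢ Set.univ) :=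
    (g.continuousOn_coordMetric x₀).comp (f := fun p : EuclideanSpace ℝ (Fin n) ×
      EuclideanSpace ℝ (Fin n) => (p.1, p.2, p.2)) (by fun_prop) (fun _ hp => ⟨hp.1, trivial⟩)
  have h1 := (hA.isOpen_inter_preimage hopen isOpen_Iio (t := Set.Iio 0)).inter
    ((g.continuousOn_coordTime x₀).isOpen_inter_preimage hopen (isOpen_Iio (a := (0 : ℝ))))
  have hmem := h1.mem_nhds (x := (y₀, T₀))
    ⟨⟨⟨hy₀, trivial⟩, by
      change g.metric _ (chartVector x₀ y₀ T₀) (chartVector x₀ y₀ T₀) < 0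
      rw [hT₀]; exact g.time_timelike _⟩,
     ⟨⟨hy₀, trivial⟩, by
      change g.metric _ _ (chartVector x₀ y₀ T₀) < 0
      rw [hT₀]; exact g.time_timelike _⟩⟩
  obtain ⟨r, hr, hb⟩ := Metric.mem_nhds_iff.1 hmem
  rw [← ball_prod_same] at hb
  exact ⟨T₀, r, hr, fun y hy => (hb (Set.mk_mem_prod hy (Metric.mem_ball_self hr))).1.1.1,
    fun y hy w hw => ⟨le_of_lt (hb (Set.mk_mem_prod hy hw)).1.2, (hb (Set.mk_mem_prod hy hw)).2.2⟩⟩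

/-- A straight coordinate segment has constant coordinate velocity `z - y`, so causality need only
be tested on this one direction. -/
theorem causalArc_of_segment (x₀ : M) {y z : EuclideanSpace ℝ (Fin n)}
    {s : Set (EuclideanSpace ℝ (Fin n))} (hs : Convex ℝ s)
    (hsub : s ⊆ (extChartAt (𝓡 n) x₀).target) (hy : y ∈ s) (hz : z ∈ s)
    (h : ∀ a ∈ s, g.FutureCausal _ (chartVector x₀ a (z - y))) :
    g.CausalArc ((extChartAt (𝓡 n) x₀).symm y) ((extChartAt (𝓡 n) x₀).symm z) := by
  set l : ℝ → EuclideanSpace ℝ (Fin n) := fun t => y + t • (z - y) with hl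
  have hls : ∀ t ∈ Set.Icc (0 : ℝ) 1, l t ∈ s := fun t ht => hs.add_smul_sub_mem hy hz ht
  have hlc : ContMDiff 𝓘(ℝ, ℝ) (𝓡 n) 1 l := by
    rw [contMDiff_iff_contDiff]
    fun_prop
  refine ⟨fun t => (extChartAt (𝓡 n) x₀).symm (l t), ?_, by simp [hl], by simp [hl], ?_⟩
  · exact (contMDiffOn_extChartAt_symm x₀).comp hlc.contMDiffOn fun t ht => hsub (hls t ht)
  · intro t ht
    have hm := mdifferentiableAt_extChartAt_symm_of_boundaryless x₀ (hsub (hls t ht))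
    have hd : HasDerivAt l (z - y) t := by
      have h := ((hasDerivAt_id t).smul_const (z - y)).const_add y
      rw [one_smul] at h
      exact h
    have hl' : HasMFDerivAt 𝓘(ℝ, ℝ) (𝓡 n) l t (ContinuousLinearMap.toSpanSingleton ℝ (z - y)) :=
      hd.hasFDerivAt.hasMFDerivAt
    have hcomp := (hm.hasMFDerivAt.comp t hl').hasMFDerivWithinAt (s := Set.Icc 0 1)
    have hu : UniqueMDiffWithinAt 𝓘(ℝ, ℝ) (Set.Icc (0 : ℝ) 1) t :=
      (uniqueDiffOn_Icc_zero_one t ht).uniqueMDiffWithinAt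
    have e := hcomp.mfderivWithin hu
    have e2 : mfderivWithin 𝓘(ℝ, ℝ) (𝓡 n) (fun t => (extChartAt (𝓡 n) x₀).symm (l t))
        (Set.Icc 0 1) t (1 : ℝ) = chartVector x₀ (l t) (z - y) := by
      refine (congrArg (fun L : ℝ →L[ℝ] EuclideanSpace ℝ (Fin n) => L 1) e).trans ?_
      change mfderiv (𝓡 n) (𝓡 n) (extChartAt (𝓡 n) x₀).symm (l t)
        (ContinuousLinearMap.toSpanSingleton ℝ (z - y) (1 : ℝ)) = _
      rw [ContinuousLinearMap.toSpanSingleton_apply, one_smul]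
      rfl
    rw [e2]
    exact h _ (hls t ht)

/-- Move from `p` a small coordinate distance along `∓T₀`. The displacement between the moved point
and any `x` close enough to `p` is `ε • (T₀ + small)`, which stays in the open cone of future
vectors. The neighbourhoods obtained here are all that the later causality arguments use of the
differential structure. -/
theorem exists_mem_JPlus_mem_nhds (p : M) {U : Set M} (hU : U ∈ 𝓝 p) :
    (∃ p' ∈ U, {x | g.CausalLE p' x} ∈ 𝓝 p) ∧ ∃ q' ∈ U, {x | g.CausalLE x q'} ∈ 𝓝 p := by
  obtain ⟨T₀, r, hr, hball, hfut⟩ := g.exists_futureCausal_ball p (mem_extChartAt_target p)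
  set φ := extChartAt (𝓡 n) p with hφ
  set y₀ := φ p with hy₀
  have hcont : ContinuousAt φ.symm y₀ := continuousAt_extChartAt_symm p
  have hcont' : ContinuousAt φ p := continuousAt_extChartAt p
  have hpy : φ.symm y₀ = p := extChartAt_to_inv p
  have key : ∀ c : ℝ, ∀ᶠ ε in 𝓝[>] (0 : ℝ), y₀ + (c * ε) • T₀ ∈ Metric.ball y₀ r ∧
      φ.symm (y₀ + (c * ε) • T₀) ∈ U := by
    intro c
    have ht : Filter.Tendsto (fun ε : ℝ => y₀ + (c * ε) • T₀) (𝓝[>] 0) (𝓝 y₀) := by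
      have : Continuous fun ε : ℝ => y₀ + (c * ε) • T₀ := by fun_prop
      have h := this.tendsto 0
      simp only [mul_zero, zero_smul, add_zero] at h
      exact h.mono_left nhdsWithin_le_nhds
    refine (ht.eventually (Metric.ball_mem_nhds y₀ hr)).and ?_
    exact ht.eventually (hcont.preimage_mem_nhds (by rwa [hpy]))
  have hnear : ∀ ε > 0, ∀ᶠ x in 𝓝 p, x ∈ φ.source ∧ φ x ∈ Metric.ball y₀ r ∧
      φ x ∈ Metric.ball y₀ (ε * r) := fun ε hε =>
    (Filter.eventually_of_mem (extChartAt_source_mem_nhds p) fun _ h => h).and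
      ((hcont'.eventually (Metric.ball_mem_nhds y₀ hr)).and
        (hcont'.eventually (Metric.ball_mem_nhds y₀ (by positivity))))
  have dir : ∀ ε > 0, ∀ v : EuclideanSpace ℝ (Fin n), ‖v‖ < ε * r → ∀ a ∈ Metric.ball y₀ r,
      g.FutureCausal _ (chartVector p a (ε • T₀ + v)) := by
    intro ε hε v hv a ha
    have hw : T₀ + ε⁻¹ • v ∈ Metric.ball T₀ r := by
      rw [mem_ball_iff_norm, add_sub_cancel_left, norm_smul, norm_inv, Real.norm_of_nonneg hε.le,
        inv_mul_lt_iff₀ hε]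
      exact hv
    have h := (hfut a ha _ hw).smul hε
    have e : ε • chartVector p a (T₀ + ε⁻¹ • v) = chartVector p a (ε • T₀ + v) := by
      rw [← chartVector_smul, smul_add, smul_inv_smul₀ hε.ne']
    rwa [e] at h
  constructor
  · obtain ⟨ε, ⟨h1, h2⟩, hε⟩ := ((key (-1)).and self_mem_nhdsWithin).exists
    refine ⟨_, h2, ?_⟩
    filter_upwards [hnear ε hε] with x ⟨hx, hx1, hx2⟩
    have := g.causalArc_of_segment p (convex_ball y₀ r) hball h1 hx1 (fun a ha => by
      have e : φ x - (y₀ + (-1 * ε) • T₀) = ε • T₀ + (φ x - y₀) := by module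
      rw [e]
      exact dir ε hε _ (mem_ball_iff_norm.1 hx2) a ha)
    rw [φ.left_inv hx] at this
    exact Relation.ReflTransGen.single this
  · obtain ⟨ε, ⟨h1, h2⟩, hε⟩ := ((key 1).and self_mem_nhdsWithin).exists
    refine ⟨_, h2, ?_⟩
    filter_upwards [hnear ε hε] with x ⟨hx, hx1, hx2⟩
    have := g.causalArc_of_segment p (convex_ball y₀ r) hball hx1 h1 (fun a ha => by
      have e : y₀ + (1 * ε) • T₀ - φ x = ε • T₀ + (y₀ - φ x) := by module
      rw [e]
      exact dir ε hε _ (by rw [norm_sub_rev]; exact mem_ball_iff_norm.1 hx2) a ha)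
    rw [φ.left_inv hx] at this
    exact Relation.ReflTransGen.single this

end LorentzianStructure

/-! ### The volume measure is locally finite and positive on open sets -/

namespace LorentzianStructure

variable {n : ℕ} {M : Type*} [TopologicalSpace M] [ChartedSpace (EuclideanSpace ℝ (Fin n)) M]
  [IsManifold (𝓡 n) ∞ M] (g : LorentzianStructure n M)

/-- A vector orthogonal to everything is orthogonal to a timelike one, so it would be spacelike if
nonzero, yet it is orthogonal to itself. -/
theorem metric_nondegenerate (x : M) {w : TangentSpace (𝓡 n) x} (h : ∀ v, g.metric x v w = 0) :
    w = 0 := by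
  obtain ⟨v, -, hv⟩ := g.signature x
  by_contra hw
  exact (hv w (h v) hw).ne' (h w)

/-- The metric in coordinates at a point, as a bilinear form. -/
noncomputable def coordForm (x₀ : M) (y : EuclideanSpace ℝ (Fin n)) :
    LinearMap.BilinForm ℝ (EuclideanSpace ℝ (Fin n)) :=
  LinearMap.mk₂ ℝ (g.coordMetric x₀ y)
    (fun a b c => by
      rw [coordMetric, chartVector_add, map_add]; rfl)
    (fun r b c => by
      rw [coordMetric, chartVector_smul, map_smul]; rfl)
    (fun a b c => by
      rw [coordMetric, chartVector_add, map_add]; rfl)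
    (fun r b c => by
      rw [coordMetric, chartVector_smul, map_smul]; rfl)

theorem toMatrix_coordForm (x₀ : M) (y : EuclideanSpace ℝ (Fin n)) :
    LinearMap.BilinForm.toMatrix (EuclideanSpace.basisFun (Fin n) ℝ).toBasis (g.coordForm x₀ y) =
      g.gram x₀ y := by
  ext i j
  rw [LinearMap.BilinForm.toMatrix_apply, OrthonormalBasis.coe_toBasis,
    EuclideanSpace.basisFun_apply, EuclideanSpace.basisFun_apply]
  rfl

theorem det_gram_ne_zero (x₀ : M) {y : EuclideanSpace ℝ (Fin n)}
    (hy : y ∈ (extChartAt (𝓡 n) x₀).target) : (g.gram x₀ y).det ≠ 0 := by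
  rw [← toMatrix_coordForm, ← LinearMap.BilinForm.nondegenerate_iff_det_ne_zero]
  have hbij := chartVector_bijective x₀ hy
  have h0 : chartVector x₀ y 0 = 0 :=
    (mfderiv (𝓡 n) (𝓡 n) (extChartAt (𝓡 n) x₀).symm y).map_zero
  have key : ∀ w : EuclideanSpace ℝ (Fin n), (∀ v, g.coordMetric x₀ y v w = 0) → w = 0 := by
    intro w hw
    refine hbij.1 (Eq.trans (g.metric_nondegenerate _ fun v => ?_) h0.symm)
    obtain ⟨v, rfl⟩ := hbij.2 v
    exact hw v
  exact ⟨fun w hw => key w fun v => (g.symm _ _ _).trans (hw v), fun w hw => key w hw⟩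

theorem continuousOn_det_gram (x₀ : M) :
    ContinuousOn (fun y => (g.gram x₀ y).det) (extChartAt (𝓡 n) x₀).target := by
  have h : ContinuousOn (fun y => g.gram x₀ y) (extChartAt (𝓡 n) x₀).target := by
    refine continuousOn_pi.2 fun i => continuousOn_pi.2 fun j => ?_
    exact (g.continuousOn_coordMetric x₀).comp (f := fun y : EuclideanSpace ℝ (Fin n) =>
      (y, EuclideanSpace.single i (1 : ℝ), EuclideanSpace.single j (1 : ℝ))) (by fun_prop)
      (fun y hy => ⟨hy, trivial⟩)
  exact (continuous_id.matrix_det).comp_continuousOn h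

/-- The coordinate change between the charts around `x₀` and `x₁`. -/
noncomputable def coordChange (x₀ x₁ : M) (y : EuclideanSpace ℝ (Fin n)) :
    EuclideanSpace ℝ (Fin n) :=
  extChartAt (𝓡 n) x₁ ((extChartAt (𝓡 n) x₀).symm y)

theorem hasFDerivAt_coordChange (x₀ x₁ : M) {y : EuclideanSpace ℝ (Fin n)}
    (hy : y ∈ (extChartAt (𝓡 n) x₀).target)
    (hy₁ : (extChartAt (𝓡 n) x₀).symm y ∈ (extChartAt (𝓡 n) x₁).source) :
    HasFDerivAt (coordChange (n := n) x₀ x₁) (fderiv ℝ (coordChange (n := n) x₀ x₁) y) y := by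
  have h1 := mdifferentiableAt_extChartAt_symm_of_boundaryless x₀ hy
  rw [extChartAt_source] at hy₁
  have h2 : MDifferentiableAt (𝓡 n) (𝓡 n) (extChartAt (𝓡 n) x₁) ((extChartAt (𝓡 n) x₀).symm y) :=
    mdifferentiableAt_extChartAt hy₁
  have h3 := h2.comp y h1
  exact (mdifferentiableAt_iff_differentiableAt.1 h3).hasFDerivAt

theorem coordMetric_coordChange (x₀ x₁ : M) {y : EuclideanSpace ℝ (Fin n)}
    (hy : y ∈ (extChartAt (𝓡 n) x₀).target)
    (hy₁ : (extChartAt (𝓡 n) x₀).symm y ∈ (extChartAt (𝓡 n) x₁).source)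
    (v w : EuclideanSpace ℝ (Fin n)) :
    g.coordMetric x₀ y v w = g.coordMetric x₁ (coordChange x₀ x₁ y)
      (fderiv ℝ (coordChange x₀ x₁) y v) (fderiv ℝ (coordChange x₀ x₁) y w) := by
  have hmem : coordChange x₀ x₁ y ∈ (extChartAt (𝓡 n) x₁).target :=
    (extChartAt (𝓡 n) x₁).map_source hy₁
  have h1 := (mdifferentiableAt_extChartAt_symm_of_boundaryless x₁ hmem).hasMFDerivAt.comp y
    (hasFDerivAt_coordChange x₀ x₁ hy hy₁).hasMFDerivAt
  have hev : (extChartAt (𝓡 n) x₀).symm =ᶠ[𝓝 y]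
      (extChartAt (𝓡 n) x₁).symm ∘ coordChange x₀ x₁ := by
    have hc := (continuousOn_extChartAt_symm (I := 𝓡 n) x₀).continuousAt
      ((isOpen_extChartAt_target (I := 𝓡 n) x₀).mem_nhds hy)
    filter_upwards [hc.preimage_mem_nhds ((isOpen_extChartAt_source (I := 𝓡 n) x₁).mem_nhds hy₁)]
      with z hz
    exact ((extChartAt (𝓡 n) x₁).left_inv hz).symm
  have h2 := h1.congr_of_eventuallyEq hev
  have h3 := hasMFDerivAt_unique
    (mdifferentiableAt_extChartAt_symm_of_boundaryless x₀ hy).hasMFDerivAt h2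
  have hpt : (extChartAt (𝓡 n) x₀).symm y = (extChartAt (𝓡 n) x₁).symm (coordChange x₀ x₁ y) :=
    hev.self_of_nhds
  have hvec : ∀ u : EuclideanSpace ℝ (Fin n), (chartVector x₀ y u : EuclideanSpace ℝ (Fin n)) =
      chartVector x₁ (coordChange x₀ x₁ y) (fderiv ℝ (coordChange x₀ x₁) y u) := fun u =>
    congrArg (fun L : EuclideanSpace ℝ (Fin n) →L[ℝ] EuclideanSpace ℝ (Fin n) => L u) h3
  have aux : ∀ (p q : M) (a b a' b' : EuclideanSpace ℝ (Fin n)), p = q → a = a' → b = b' →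
      (g.metric p : EuclideanSpace ℝ (Fin n) →L[ℝ] EuclideanSpace ℝ (Fin n) →L[ℝ] ℝ) a b =
      (g.metric q : EuclideanSpace ℝ (Fin n) →L[ℝ] EuclideanSpace ℝ (Fin n) →L[ℝ] ℝ) a' b' := by
    rintro p _ a b _ _ rfl rfl rfl
    rfl
  exact aux _ _ _ _ _ _ hpt (hvec v) (hvec w)

/-- Congruence of Gram matrices under the Jacobian, with the determinant of the Jacobian appearing
twice. -/
theorem det_gram_coordChange (x₀ x₁ : M) {y : EuclideanSpace ℝ (Fin n)}
    (hy : y ∈ (extChartAt (𝓡 n) x₀).target)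
    (hy₁ : (extChartAt (𝓡 n) x₀).symm y ∈ (extChartAt (𝓡 n) x₁).source) :
    (g.gram x₀ y).det = (fderiv ℝ (coordChange x₀ x₁) y).det ^ 2 *
      (g.gram x₁ (coordChange x₀ x₁ y)).det := by
  set L := fderiv ℝ (coordChange (n := n) x₀ x₁) y
  have h : g.coordForm x₀ y =
      (g.coordForm x₁ (coordChange x₀ x₁ y)).comp (L : _ →ₗ[ℝ] _) (L : _ →ₗ[ℝ] _) := by
    refine LinearMap.ext₂ fun v w => ?_
    exact g.coordMetric_coordChange x₀ x₁ hy hy₁ v w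
  rw [← toMatrix_coordForm, h, LinearMap.BilinForm.toMatrix_comp
    (EuclideanSpace.basisFun (Fin n) ℝ).toBasis (EuclideanSpace.basisFun (Fin n) ℝ).toBasis,
    toMatrix_coordForm,
    Matrix.det_mul, Matrix.det_mul, Matrix.det_transpose, LinearMap.det_toMatrix]
  change L.det * _ * L.det = _
  ring

/-- The density `√|det g|` in coordinates. -/
noncomputable def density (x₀ : M) (y : EuclideanSpace ℝ (Fin n)) : ℝ≥0∞ :=
  ENNReal.ofReal (Real.sqrt |(g.gram x₀ y).det|)

theorem density_coordChange (x₀ x₁ : M) {y : EuclideanSpace ℝ (Fin n)}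
    (hy : y ∈ (extChartAt (𝓡 n) x₀).target)
    (hy₁ : (extChartAt (𝓡 n) x₀).symm y ∈ (extChartAt (𝓡 n) x₁).source) :
    g.density x₀ y = ENNReal.ofReal |(fderiv ℝ (coordChange x₀ x₁) y).det| *
      g.density x₁ (coordChange x₀ x₁ y) := by
  rw [density, density, g.det_gram_coordChange x₀ x₁ hy hy₁, abs_mul, abs_pow,
    Real.sqrt_mul (by positivity), Real.sqrt_sq (abs_nonneg _),
    ENNReal.ofReal_mul (abs_nonneg _)]

theorem continuousOn_density (x₀ : M) :
    ContinuousOn (g.density x₀) (extChartAt (𝓡 n) x₀).target :=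
  ENNReal.continuous_ofReal.comp_continuousOn
    (Real.continuous_sqrt.comp_continuousOn (g.continuousOn_det_gram x₀).abs)

theorem density_pos (x₀ : M) {y : EuclideanSpace ℝ (Fin n)}
    (hy : y ∈ (extChartAt (𝓡 n) x₀).target) : 0 < g.density x₀ y :=
  ENNReal.ofReal_pos.2 (Real.sqrt_pos.2 (abs_pos.2 (g.det_gram_ne_zero x₀ hy)))

variable [MeasurableSpace M] [BorelSpace M]

theorem localVolume_apply (x₀ : M) {A : Set M} (hA : MeasurableSet A) :
    g.localVolume x₀ A = ∫⁻ y in (extChartAt (𝓡 n) x₀).symm ⁻¹' A ∩ (extChartAt (𝓡 n) x₀).target,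
      g.density x₀ y := by
  have ho := (isOpen_extChartAt_target (I := 𝓡 n) x₀).measurableSet
  have hm : AEMeasurable (extChartAt (𝓡 n) x₀).symm
      (volume.restrict (extChartAt (𝓡 n) x₀).target) :=
    (continuousOn_extChartAt_symm x₀).aemeasurable ho
  rw [localVolume, Measure.map_apply_of_aemeasurable
    (hm.mono_ac (withDensity_absolutelyContinuous _ _)) hA, withDensity_apply',
    Measure.restrict_restrict' ho]
  rfl

omit [IsManifold (𝓡 n) ∞ M] in
theorem measurableSet_chart_preimage (x₀ : M) {A : Set M} (hA : MeasurableSet A) :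
    MeasurableSet ((extChartAt (𝓡 n) x₀).symm ⁻¹' A ∩ (extChartAt (𝓡 n) x₀).target) := by
  have ho := (isOpen_extChartAt_target (I := 𝓡 n) x₀).measurableSet
  have hc := continuousOn_iff_continuous_domRestrict.1 (continuousOn_extChartAt_symm (I := 𝓡 n) x₀)
  have := ho.subtype_image (hc.measurable hA)
  convert this using 1
  ext y
  simp [and_comm]

/-- Change of variables. Only an inequality, since `A` need not lie in the chart around `x₀`, and
`localVolume x₀` sees only the part that does. -/
theorem localVolume_le_localVolume (x₀ x₁ : M) {A : Set M} (hA : MeasurableSet A)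
    (hsub : A ⊆ (extChartAt (𝓡 n) x₁).source) : g.localVolume x₀ A ≤ g.localVolume x₁ A := by
  rw [localVolume_apply g x₀ hA, localVolume_apply g x₁ hA]
  set B := (extChartAt (𝓡 n) x₀).symm ⁻¹' A ∩ (extChartAt (𝓡 n) x₀).target
  have hB : MeasurableSet B := measurableSet_chart_preimage x₀ hA
  have hinj : Set.InjOn (coordChange (n := n) x₀ x₁) B := by
    intro y hy z hz h
    exact (extChartAt (𝓡 n) x₀).symm.injOn hy.2 hz.2
      ((extChartAt (𝓡 n) x₁).injOn (hsub hy.1) (hsub hz.1) h)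
  have hcv := lintegral_image_eq_lintegral_abs_det_fderiv_mul volume hB
    (fun y hy => (hasFDerivAt_coordChange x₀ x₁ hy.2 (hsub hy.1)).hasFDerivWithinAt) hinj
    (g.density x₁)
  calc ∫⁻ y in B, g.density x₀ y
      = ∫⁻ y in B, ENNReal.ofReal |(fderiv ℝ (coordChange (n := n) x₀ x₁) y).det| *
          g.density x₁ (coordChange x₀ x₁ y) :=
        setLIntegral_congr_fun hB fun y hy => g.density_coordChange x₀ x₁ hy.2 (hsub hy.1)
    _ = ∫⁻ y in coordChange x₀ x₁ '' B, g.density x₁ y := hcv.symm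
    _ ≤ _ := lintegral_mono_set ?_
  rintro _ ⟨y, hy, rfl⟩
  refine ⟨?_, (extChartAt (𝓡 n) x₁).map_source (hsub hy.1)⟩
  change (extChartAt (𝓡 n) x₁).symm (coordChange x₀ x₁ y) ∈ A
  rw [coordChange, (extChartAt (𝓡 n) x₁).left_inv (hsub hy.1)]
  exact hy.1

/-- A supremum of measures cannot be evaluated set by set, so it is bounded by a measure dominating
every local volume. -/
theorem volumeMeasure_le_localVolume (x₁ : M) {A : Set M} (hA : MeasurableSet A)
    (hsub : A ⊆ (extChartAt (𝓡 n) x₁).source) : g.volumeMeasure A ≤ g.localVolume x₁ A := by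
  set U := (extChartAt (𝓡 n) x₁).source
  have hU : MeasurableSet U := (isOpen_extChartAt_source (I := 𝓡 n) x₁).measurableSet
  -- Inside the chart domain the first summand dominates, outside it the second; the latter does not
  -- charge `A`.
  have h : g.volumeMeasure ≤ g.localVolume x₁ + g.volumeMeasure.restrict Uᶜ := by
    refine iSup_le fun x₀ => Measure.le_iff.2 fun B hB => ?_
    rw [← measure_inter_add_sdiff B hU, Measure.add_apply, Measure.restrict_apply hB]
    refine add_le_add ?_ (le_iSup g.localVolume x₀ _)
    exact (g.localVolume_le_localVolume x₀ x₁ (hB.inter hU) Set.inter_subset_right).trans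
      (measure_mono Set.inter_subset_left)
  refine (h A).trans ?_
  rw [Measure.add_apply, Measure.restrict_apply hA,
    show A ∩ Uᶜ = ∅ from Set.disjoint_iff_inter_eq_empty.1
      (Set.disjoint_compl_right_iff_subset.2 hsub), measure_empty, add_zero]

theorem isLocallyFiniteMeasure_volumeMeasure : IsLocallyFiniteMeasure g.volumeMeasure := by
  refine ⟨fun x => ?_⟩
  set φ := extChartAt (𝓡 n) x with hφ
  have hc : ContinuousAt (g.density x) (φ x) := (g.continuousOn_density x).continuousAt
    (extChartAt_target_mem_nhds x)
  have h1 : ∀ᶠ y in 𝓝 (φ x), g.density x y < g.density x (φ x) + 1 :=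
    hc.eventually (gt_mem_nhds (ENNReal.lt_add_right ENNReal.ofReal_ne_top one_ne_zero))
  obtain ⟨r, hr, hball⟩ := Metric.eventually_nhds_iff_ball.1 h1
  set W := φ.source ∩ φ ⁻¹' Metric.ball (φ x) r with hW
  have hWo : IsOpen W := (continuousOn_extChartAt x).isOpen_inter_preimage
    (isOpen_extChartAt_source x) Metric.isOpen_ball
  refine ⟨W, hWo.mem_nhds ⟨mem_extChartAt_source x, Metric.mem_ball_self hr⟩, ?_⟩
  refine (g.volumeMeasure_le_localVolume x hWo.measurableSet Set.inter_subset_left).trans_lt ?_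
  rw [localVolume_apply g x hWo.measurableSet]
  calc ∫⁻ y in φ.symm ⁻¹' W ∩ φ.target, g.density x y
      ≤ ∫⁻ y in Metric.ball (φ x) r, g.density x y := by
        refine lintegral_mono_set fun y hy => ?_
        have := hy.1.2
        rwa [Set.mem_preimage, φ.right_inv hy.2] at this
    _ ≤ ∫⁻ y in Metric.ball (φ x) r, (g.density x (φ x) + 1) :=
        setLIntegral_mono measurable_const fun y hy => (hball y hy).le
    _ < ⊤ := by
        rw [setLIntegral_const]
        exact ENNReal.mul_lt_top (ENNReal.add_lt_top.2 ⟨ENNReal.ofReal_lt_top, ENNReal.one_lt_top⟩)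
          measure_ball_lt_top

theorem isOpenPosMeasure_volumeMeasure : g.volumeMeasure.IsOpenPosMeasure := by
  refine ⟨fun U hU ⟨x, hx⟩ h0 => ?_⟩
  have h1 : g.localVolume x U = 0 := le_antisymm ((le_iSup g.localVolume x U).trans h0.le) zero_le
  rw [localVolume_apply g x hU.measurableSet] at h1
  set B := (extChartAt (𝓡 n) x).symm ⁻¹' U ∩ (extChartAt (𝓡 n) x).target
  have hB : MeasurableSet B := measurableSet_chart_preimage x hU.measurableSet
  have hBo : IsOpen B := by
    have := (continuousOn_extChartAt_symm (I := 𝓡 n) x).isOpen_inter_preimage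
      (isOpen_extChartAt_target x) hU
    rwa [Set.inter_comm] at this
  have hBne : B.Nonempty := ⟨extChartAt (𝓡 n) x x, by
    simpa [B] using hx⟩
  have hae : AEMeasurable (g.density x) (volume.restrict B) :=
    ((g.continuousOn_density x).mono Set.inter_subset_right).aemeasurable hB
  have hF : ∀ᵐ _ ∂(volume.restrict B), False := by
    filter_upwards [(lintegral_eq_zero_iff' hae).1 h1, ae_restrict_mem hB] with y hy hyB
    exact (g.density_pos x hyB.2).ne' hy
  rw [Filter.eventually_false_iff_eq_bot, ae_eq_bot, Measure.restrict_eq_zero] at hF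
  exact hBo.measure_ne_zero volume hBne hF

end LorentzianStructure

/-! ### Local operators, cutoffs and non-degeneracy of the pairing -/

section Sections

variable {n : ℕ} {M : Type*} [TopologicalSpace M] [ChartedSpace (EuclideanSpace ℝ (Fin n)) M]
  {F : Type*} [NormedAddCommGroup F] [NormedSpace ℂ F] {V : M → Type*}
  [∀ x, AddCommGroup (V x)] [∀ x, Module ℂ (V x)] [∀ x, TopologicalSpace (V x)]
  [TopologicalSpace (TotalSpace F V)] [FiberBundle F V] [VectorBundle ℂ F V]
  {F' : Type*} [NormedAddCommGroup F'] [NormedSpace ℂ F'] {W : M → Type*}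
  [∀ x, AddCommGroup (W x)] [∀ x, Module ℂ (W x)] [∀ x, TopologicalSpace (W x)]
  [TopologicalSpace (TotalSpace F' W)] [FiberBundle F' W] [VectorBundle ℂ F' W]
  {F'' : Type*} [NormedAddCommGroup F''] [NormedSpace ℂ F''] {X : M → Type*}
  [∀ x, AddCommGroup (X x)] [∀ x, Module ℂ (X x)] [∀ x, TopologicalSpace (X x)]
  [TopologicalSpace (TotalSpace F'' X)] [FiberBundle F'' X] [VectorBundle ℂ F'' X]

theorem notMem_secSupp {u : Sec n F V} {x : M} : x ∉ secSupp u ↔ ∀ᶠ y in 𝓝 x, u.1 y = 0 := by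
  rw [secSupp, mem_closure_iff_frequently, Filter.not_frequently]
  simp only [Set.mem_ofPred_eq, not_not]

theorem eq_zero_of_notMem_secSupp {u : Sec n F V} {x : M} (h : x ∉ secSupp u) : u.1 x = 0 :=
  (notMem_secSupp.1 h).self_of_nhds

theorem isClosed_secSupp (u : Sec n F V) : IsClosed (secSupp u) := isClosed_closure

theorem secSupp_subset_of_isClosed {u : Sec n F V} {s : Set M} (hs : IsClosed s)
    (h : ∀ x ∉ s, u.1 x = 0) : secSupp u ⊆ s :=
  closure_minimal (fun x hx => by_contra fun hxs => hx (h x hxs)) hs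

theorem secSupp_sub (u v : Sec n F V) : secSupp (u - v) ⊆ secSupp u ∪ secSupp v :=
  secSupp_subset_of_isClosed ((isClosed_secSupp u).union (isClosed_secSupp v)) fun x hx => by
    rw [Set.mem_union, not_or] at hx
    change u.1 x - v.1 x = 0
    rw [eq_zero_of_notMem_secSupp hx.1, eq_zero_of_notMem_secSupp hx.2, sub_zero]

/-- The product of a smooth function and a smooth section. -/
def mulSec (f : M → ℂ) (hf : ContMDiff (𝓡 n) 𝓘(ℝ, ℂ) ∞ f) (u : Sec n F V) : Sec n F V :=
  ⟨fun x => f x • u.1 x, by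
    intro x₀
    have h := u.2 x₀
    rw [contMDiffAt_section] at h ⊢
    have hs : ContMDiff 𝓘(ℝ, ℂ × F) 𝓘(ℝ, F) ∞ (fun p : ℂ × F => p.1 • p.2) :=
      (isBoundedBilinearMap_smul (𝕜 := ℝ)).contDiff.contMDiff
    have hc := hs.contMDiffAt.comp x₀ ((hf x₀).prodMk_space h)
    refine hc.congr_of_eventuallyEq ?_
    filter_upwards [(trivializationAt F V x₀).open_baseSet.mem_nhds
      (mem_baseSet_trivializationAt F V x₀)] with y hy
    exact ((trivializationAt F V x₀).linear ℂ hy).map_smul (f y) (u.1 y)⟩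

theorem secSupp_mulSec_subset (f : M → ℂ) (hf : ContMDiff (𝓡 n) 𝓘(ℝ, ℂ) ∞ f) (u : Sec n F V) :
    secSupp (mulSec f hf u) ⊆ secSupp u :=
  secSupp_subset_of_isClosed (isClosed_secSupp u) fun x hx => by
    change f x • u.1 x = 0
    rw [eq_zero_of_notMem_secSupp hx, smul_zero]

theorem secSupp_mulSec_subset_of_isClosed {f : M → ℂ} (hf : ContMDiff (𝓡 n) 𝓘(ℝ, ℂ) ∞ f)
    (u : Sec n F V) {s : Set M} (hs : IsClosed s) (h : ∀ x ∉ s, f x = 0) :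
    secSupp (mulSec f hf u) ⊆ s :=
  secSupp_subset_of_isClosed hs fun x hx => by
    change f x • u.1 x = 0
    rw [h x hx, zero_smul]

/-- `A` is a local operator: if `u` vanishes near `x`, then so does `A u`. -/
def IsLocalOp (A : Sec n F V →ₗ[ℂ] Sec n F' W) : Prop :=
  ∀ (u : Sec n F V) (x : M), (∀ᶠ y in 𝓝 x, u.1 y = 0) → (A u).1 x = 0

namespace IsLocalOp

variable {A B : Sec n F V →ₗ[ℂ] Sec n F' W}

theorem secSupp_subset (hA : IsLocalOp A) (u : Sec n F V) : secSupp (A u) ⊆ secSupp u :=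
  secSupp_subset_of_isClosed (isClosed_secSupp u) fun x hx => hA u x (notMem_secSupp.1 hx)

theorem congr (hA : IsLocalOp A) {u v : Sec n F V} {x : M} (h : ∀ᶠ y in 𝓝 x, u.1 y = v.1 y) :
    (A u).1 x = (A v).1 x := by
  have h1 : (A (u - v)).1 x = 0 := hA _ x (h.mono fun y hy => sub_eq_zero.2 hy)
  rw [map_sub] at h1
  exact sub_eq_zero.1 h1

theorem comp (hA : IsLocalOp A) {C : Sec n F' W →ₗ[ℂ] Sec n F'' X} (hC : IsLocalOp C) :
    IsLocalOp (C ∘ₗ A) := fun u x h =>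
  hC _ x (h.eventually_nhds.mono fun y hy => hA u y hy)

theorem add (hA : IsLocalOp A) (hB : IsLocalOp B) : IsLocalOp (A + B) := fun u x h => by
  change (A u).1 x + (B u).1 x = 0
  rw [hA u x h, hB u x h, add_zero]

/-- The restriction of a local operator to compactly supported sections. -/
def mapC (hA : IsLocalOp A) : SecC n F V →ₗ[ℂ] SecC n F' W :=
  A.restrict fun u hu => IsCompact.of_isClosed_subset (s := secSupp u) hu (isClosed_secSupp _)
    (hA.secSupp_subset u)

@[simp] theorem coe_mapC (hA : IsLocalOp A) (u : SecC n F V) : (hA.mapC u : Sec n F' W) = A u := rfl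

theorem map_mem_secC (hA : IsLocalOp A) {u : Sec n F V} (hu : u ∈ SecC n F V) :
    A u ∈ SecC n F' W := (hA.mapC ⟨u, hu⟩).2

theorem map_mem_secSC [IsManifold (𝓡 n) ∞ M] {g : LorentzianStructure n M} (hA : IsLocalOp A)
    {u : Sec n F V} (hu : u ∈ SecSC F V g) : A u ∈ SecSC F' W g := by
  obtain ⟨K, hK, h⟩ := hu
  exact ⟨K, hK, (hA.secSupp_subset u).trans h⟩

end IsLocalOp

/-- A section that vanishes near `x` has zero jets at `x`. From here on, locality is the only
property of differential operators in use. -/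
theorem IsDiffOp.isLocalOp {A : Sec n F V →ₗ[ℂ] Sec n F' W} (hA : IsDiffOp A) : IsLocalOp A := by
  obtain ⟨m, hm⟩ := hA
  intro u x hu
  refine hm u x fun k _ => ?_
  have hbase : ∀ᶠ y in 𝓝 x, y ∈ (trivializationAt F V x).baseSet ∧ u.1 y = 0 :=
    (Filter.eventually_of_mem ((trivializationAt F V x).open_baseSet.mem_nhds
      (mem_baseSet_trivializationAt F V x)) fun _ h => h).and hu
  have hc : Filter.Tendsto (extChartAt (𝓡 n) x).symm (𝓝 (extChartAt (𝓡 n) x x)) (𝓝 x) := by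
    have := continuousAt_extChartAt_symm (I := 𝓡 n) x
    rwa [ContinuousAt, extChartAt_to_inv] at this
  have h0 : (fun y => (trivializationAt F V x ⟨(extChartAt (𝓡 n) x).symm y,
      u.1 ((extChartAt (𝓡 n) x).symm y)⟩).2) =ᶠ[𝓝 (extChartAt (𝓡 n) x x)] fun _ => 0 := by
    filter_upwards [hc.eventually hbase] with y hy
    rw [hy.2]
    exact ((trivializationAt F V x).linear ℂ hy.1).map_zero
  rw [(h0.iteratedFDeriv ℝ k).eq_of_nhds]
  exact congrFun (iteratedFDeriv_fun_zero (n := k)) _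

variable [T2Space M] [SecondCountableTopology M] [IsManifold (𝓡 n) ∞ M]

variable (n) in
theorem exists_cutoff {s : Set M} (hs : IsCompact s) {U : Set M} (hU : IsOpen U) (hsU : s ⊆ U) :
    ∃ f : M → ℝ, ContMDiff (𝓡 n) 𝓘(ℝ, ℝ) ∞ f ∧ (∀ᶠ x in 𝓝ˢ s, f x = 1) ∧
      ∃ t, IsCompact t ∧ t ⊆ U ∧ ∀ x ∉ t, f x = 0 := by
  have : LocallyCompactSpace M := ChartedSpace.locallyCompactSpace (EuclideanSpace ℝ (Fin n)) M
  obtain ⟨t, ht, hst, htU⟩ := exists_compact_between hs hU hsU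
  obtain ⟨f, hf1, hf0, -⟩ :=
    exists_contMDiffMap_one_nhds_of_subset_interior (n := (⊤ : ℕ∞)) (𝓡 n) hs.isClosed hst
  exact ⟨f, f.contMDiff, hf1, t, ht, htU, hf0⟩

variable (n) in
theorem exists_complex_cutoff {s : Set M} (hs : IsCompact s) :
    ∃ f : M → ℂ, ContMDiff (𝓡 n) 𝓘(ℝ, ℂ) ∞ f ∧ (∀ᶠ x in 𝓝ˢ s, f x = 1) ∧
      ∃ t, IsCompact t ∧ ∀ x ∉ t, f x = 0 := by
  obtain ⟨f, hf, h1, t, ht, -, h0⟩ := exists_cutoff n hs isOpen_univ (Set.subset_univ s)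
  refine ⟨fun x => (f x : ℂ), ?_, h1.mono fun x hx => by simp only [hx, Complex.ofReal_one], t, ht,
    fun x hx => by simp only [h0 x hx, Complex.ofReal_zero]⟩
  exact Complex.ofRealCLM.contDiff.contMDiff.comp hf

omit [SecondCountableTopology M] [IsManifold (𝓡 n) ∞ M] in
theorem mulSec_mem_secC {f : M → ℂ} (hf : ContMDiff (𝓡 n) 𝓘(ℝ, ℂ) ∞ f) (u : Sec n F V) {t : Set M}
    (ht : IsCompact t) (h : ∀ x ∉ t, f x = 0) : mulSec f hf u ∈ SecC n F V :=
  ht.of_isClosed_subset (isClosed_secSupp _)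
    (secSupp_mulSec_subset_of_isClosed hf u ht.isClosed h)

/-- Take the section that is constant in a trivialization and multiply it by a cutoff supported
there. -/
theorem exists_mem_secC_apply_eq [ContMDiffVectorBundle ∞ F V (𝓡 n)] (x : M) (v : V x) :
    ∃ s ∈ SecC n F V, s.1 x = v := by
  set e := trivializationAt F V x
  have hx : x ∈ e.baseSet := mem_baseSet_trivializationAt F V x
  set w : F := (e ⟨x, v⟩).2
  obtain ⟨f, hf, h1, t, ht, htU, h0⟩ := exists_cutoff n (isCompact_singleton (x := x))
    e.open_baseSet (Set.singleton_subset_iff.2 hx)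
  have hloc : ContMDiffOn (𝓡 n) ((𝓡 n).prod 𝓘(ℝ, F)) ∞
      (fun y => TotalSpace.mk' F y (e.symm y w)) e.baseSet := by
    have hm : ContMDiffOn (𝓡 n) ((𝓡 n).prod 𝓘(ℝ, F)) ∞ (fun y : M => (y, w)) e.baseSet :=
      contMDiffOn_id.prodMk contMDiffOn_const
    refine (e.contMDiffOn_symm.comp hm fun y hy => e.mem_target.2 hy).congr fun y hy => ?_
    exact e.mk_symm hy w
  have hts : tsupport f ⊆ t :=
    closure_minimal (fun y hy => by_contra fun hyt => hy (h0 y hyt)) ht.isClosed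
  refine ⟨⟨f • fun y => e.symm y w,
    hf.contMDiffOn.smul_section_of_tsupport e.open_baseSet (hts.trans htU) hloc⟩, ?_, ?_⟩
  · refine ht.of_isClosed_subset (isClosed_secSupp _)
      (secSupp_subset_of_isClosed ht.isClosed fun y hy => ?_)
    change f y • e.symm y w = 0
    rw [h0 y hy, zero_smul]
  · change f x • e.symm x w = v
    rw [h1.self_of_nhdsSet x rfl, one_smul]
    exact e.symm_apply_apply_mk hx v

variable [MeasurableSpace M] [BorelSpace M] (g : LorentzianStructure n M)
  (h : HermitianStructure n F V)

omit [T2Space M] [SecondCountableTopology M] [BorelSpace M] in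
theorem conj_pairing (u v : Sec n F V) : (starRingEnd ℂ) (pairing g h u v) = pairing g h v u := by
  rw [pairing, pairing, ← integral_conj]
  simp only [h.symm]

/-- For a compactly supported `s`, test against `s` times the conjugate of the function `(u, s)`:
the pairing becomes the integral of `|(u, s)|²`, so this continuous function vanishes everywhere. -/
theorem eq_zero_of_pairing_eq_zero [ContMDiffVectorBundle ∞ F V (𝓡 n)] {u : Sec n F V}
    (hu : ∀ v ∈ SecC n F V, pairing g h u v = 0) : u = 0 := by
  ext x
  refine h.nondegenerate x _ fun w => ?_
  obtain ⟨s, hs, rfl⟩ := exists_mem_secC_apply_eq (n := n) (F := F) x w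
  have hf := h.smooth u s
  have hfc : ContMDiff (𝓡 n) 𝓘(ℝ, ℂ) ∞ fun x => (starRingEnd ℂ) (h.form x (u.1 x) (s.1 x)) :=
    Complex.conjCLE.contDiff.contMDiff.comp hf
  have hv := hu (mulSec _ hfc s) (IsCompact.of_isClosed_subset (s := secSupp s) hs
    (isClosed_secSupp _) (secSupp_mulSec_subset _ hfc s))
  have hint : pairing g h u (mulSec _ hfc s) =
      ((∫ x, ‖h.form x (u.1 x) (s.1 x)‖ ^ 2 ∂g.volumeMeasure : ℝ) : ℂ) := by
    refine Eq.trans ?_ integral_complex_ofReal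
    refine integral_congr_ae (Filter.Eventually.of_forall fun y => ?_)
    change h.form y (u.1 y) ((starRingEnd ℂ) (h.form y (u.1 y) (s.1 y)) • s.1 y) = _
    rw [map_smul, smul_eq_mul, Complex.conj_mul']
    norm_cast
  rw [hint, Complex.ofReal_eq_zero] at hv
  by_contra hne
  have := g.isLocallyFiniteMeasure_volumeMeasure
  have := g.isOpenPosMeasure_volumeMeasure
  refine (Continuous.integral_pos_of_hasCompactSupport_nonneg_nonzero (μ := g.volumeMeasure)
    (f := fun x => ‖h.form x (u.1 x) (s.1 x)‖ ^ 2) (x := x) (hf.continuous.norm.pow 2) ?_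
    (fun y => by positivity) (by simpa using hne)).ne' hv
  refine HasCompactSupport.intro (K := secSupp s) hs fun y hy => ?_
  rw [eq_zero_of_notMem_secSupp hy, map_zero, norm_zero]
  norm_num

end Sections

/-! ### Causal relations -/

section Causality

variable {M : Type*} [TopologicalSpace M]

/-- The properties of the causal relation of a globally hyperbolic spacetime that are invariant
under reversal of time. -/
structure IsCausalRel (r : M → M → Prop) : Prop where
  refl : ∀ p, r p p
  trans : ∀ p q s, r p q → r q s → r p s
  isCompact_diamond : ∀ p q, IsCompact {x | r p x ∧ r x q}
  exists_past : ∀ p, ∀ U ∈ 𝓝 p, ∃ p' ∈ U, {x | r p' x} ∈ 𝓝 p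
  exists_future : ∀ p, ∀ U ∈ 𝓝 p, ∃ q' ∈ U, {x | r x q'} ∈ 𝓝 p

/-- The set of all points in relation with some point of `A`. -/
def fut (r : M → M → Prop) (A : Set M) : Set M := {q | ∃ p ∈ A, r p q}

namespace IsCausalRel

variable {r : M → M → Prop}

theorem swap (hr : IsCausalRel r) : IsCausalRel fun p q => r q p where
  refl := hr.refl
  trans p q s h1 h2 := hr.trans s q p h2 h1
  isCompact_diamond p q := by
    have := hr.isCompact_diamond q p
    simpa only [and_comm] using this
  exists_past := hr.exists_future
  exists_future := hr.exists_past

theorem subset_fut (hr : IsCausalRel r) (A : Set M) : A ⊆ fut r A := fun p hp => ⟨p, hp, hr.refl p⟩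

theorem fut_subset_fut (hr : IsCausalRel r) {A B : Set M} (h : A ⊆ fut r B) :
    fut r A ⊆ fut r B := by
  rintro q ⟨p, hp, hpq⟩
  obtain ⟨s, hs, hsp⟩ := h hp
  exact ⟨s, hs, hr.trans _ _ _ hsp hpq⟩

/-- The covering points may be taken slightly to the past of `C`, so they inherit any property that
holds near `C`. -/
theorem exists_finite_cover (hr : IsCausalRel r) {C : Set M} (hC : IsCompact C) {P : M → Prop}
    (h : ∀ c ∈ C, ∀ᶠ p in 𝓝 c, P p) :
    ∃ t : Set M, t.Finite ∧ (∀ p ∈ t, P p) ∧ C ⊆ fut r t := by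
  refine hC.induction_on (p := fun C => ∃ t : Set M, t.Finite ∧ (∀ p ∈ t, P p) ∧ C ⊆ fut r t)
    ⟨∅, Set.finite_empty, by simp, Set.empty_subset _⟩ ?_ ?_ ?_
  · rintro A B hAB ⟨t, ht, hP, hB⟩
    exact ⟨t, ht, hP, hAB.trans hB⟩
  · rintro A B ⟨t, ht, hP, hA⟩ ⟨t', ht', hP', hB⟩
    refine ⟨t ∪ t', ht.union ht', fun p hp => hp.elim (hP p) (hP' p), ?_⟩
    rintro x (hx | hx)
    · obtain ⟨p, hp, hpx⟩ := hA hx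
      exact ⟨p, Or.inl hp, hpx⟩
    · obtain ⟨p, hp, hpx⟩ := hB hx
      exact ⟨p, Or.inr hp, hpx⟩
  · intro c hc
    obtain ⟨p', hp', hn⟩ := hr.exists_past c _ (h c hc)
    exact ⟨_, mem_nhdsWithin_of_mem_nhds hn, {p'}, Set.finite_singleton p', by simpa using hp',
      fun x hx => ⟨p', rfl, hx⟩⟩

variable [T2Space M]

/-- Near `x`, the future of `p` agrees with the compact diamond from `p` to some `q` whose past is a
neighbourhood of `x`. -/
theorem isClosed_setOf (hr : IsCausalRel r) (p : M) : IsClosed {x | r p x} := by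
  refine isClosed_of_closure_subset fun x hx => ?_
  obtain ⟨q, -, hq⟩ := hr.exists_future x Set.univ Filter.univ_mem
  have h := (hr.isCompact_diamond p q).isClosed
  have hx' : x ∈ closure {x | r p x ∧ r x q} := by
    rw [mem_closure_iff_nhds] at hx ⊢
    intro t ht
    obtain ⟨y, ⟨hy1, hy2⟩, hy3⟩ := hx _ (Filter.inter_mem ht hq)
    exact ⟨y, hy1, hy3, hy2⟩
  rw [h.closure_eq] at hx'
  exact hx'.1

theorem isClosed_fut_of_finite (hr : IsCausalRel r) {t : Set M} (ht : t.Finite) :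
    IsClosed (fut r t) := by
  have : fut r t = ⋃ p ∈ t, {x | r p x} := by
    ext x
    simp [fut]
  rw [this]
  exact ht.isClosed_biUnion fun p _ => hr.isClosed_setOf p

/-- If `x` is not in the future of `C`, points near `C` do not precede `x` either, as the past of
`x` is closed. Finitely many of them have a closed joint future that contains that of `C` and misses
`x`. -/
theorem isClosed_fut (hr : IsCausalRel r) {C : Set M} (hC : IsCompact C) : IsClosed (fut r C) := by
  refine isClosed_of_closure_subset fun x hx => by_contra fun hxC => ?_
  have hP : ∀ c ∈ C, ∀ᶠ p in 𝓝 c, ¬ r p x := fun c hc =>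
    (hr.swap.isClosed_setOf x).isOpen_compl.mem_nhds fun h => hxC ⟨c, hc, h⟩
  obtain ⟨t, ht, htP, hCt⟩ := hr.exists_finite_cover hC hP
  obtain ⟨p, hp, hpx⟩ :=
    closure_minimal (hr.fut_subset_fut hCt) (hr.isClosed_fut_of_finite ht) hx
  exact htP p hp hpx

/-- Replacing `C` and `C'` by finite sets puts the intersection inside a finite union of diamonds.
-/
theorem isCompact_fut_inter (hr : IsCausalRel r) {C C' : Set M} (hC : IsCompact C)
    (hC' : IsCompact C') : IsCompact (fut r C ∩ fut (fun p q => r q p) C') := by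
  obtain ⟨t, ht, -, hCt⟩ := hr.exists_finite_cover hC (P := fun _ => True) (by simp)
  obtain ⟨t', ht', -, hCt'⟩ := hr.swap.exists_finite_cover hC' (P := fun _ => True) (by simp)
  have hK : IsCompact (⋃ p ∈ t, ⋃ q ∈ t', {x | r p x ∧ r x q}) :=
    ht.isCompact_biUnion fun p _ => ht'.isCompact_biUnion fun q _ => hr.isCompact_diamond p q
  refine hK.of_isClosed_subset ((hr.isClosed_fut hC).inter (hr.swap.isClosed_fut hC')) ?_
  rintro x ⟨hx, hx'⟩
  obtain ⟨p, hp, hpx⟩ := hr.fut_subset_fut hCt hx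
  obtain ⟨q, hq, hqx⟩ := hr.swap.fut_subset_fut hCt' hx'
  simp only [Set.mem_iUnion]
  exact ⟨p, hp, q, hq, hpx, hqx⟩

end IsCausalRel

theorem LorentzianStructure.isCausalRel {n : ℕ} [ChartedSpace (EuclideanSpace ℝ (Fin n)) M]
    [IsManifold (𝓡 n) ∞ M] {g : LorentzianStructure n M} (hg : g.GloballyHyperbolic) :
    IsCausalRel g.CausalLE where
  refl _ := Relation.ReflTransGen.refl
  trans _ _ _ := Relation.ReflTransGen.trans
  isCompact_diamond p q := by
    have := hg.2 p q
    convert this using 1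
    ext x
    simp [JPlus, JMinus]
  exists_past p _ hU := (g.exists_mem_JPlus_mem_nhds p hU).1
  exists_future p _ hU := (g.exists_mem_JPlus_mem_nhds p hU).2

end Causality

/-! ### Propagators -/

section Propagators

variable {n : ℕ} {M : Type*} [TopologicalSpace M] [ChartedSpace (EuclideanSpace ℝ (Fin n)) M]
  [T2Space M] [SecondCountableTopology M] [IsManifold (𝓡 n) ∞ M]
  {F : Type*} [NormedAddCommGroup F] [NormedSpace ℂ F] {V : M → Type*}
  [∀ x, AddCommGroup (V x)] [∀ x, Module ℂ (V x)] [∀ x, TopologicalSpace (V x)]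
  [TopologicalSpace (TotalSpace F V)] [FiberBundle F V] [VectorBundle ℂ F V]
  {r : M → M → Prop} {D : Sec n F V →ₗ[ℂ] Sec n F V} {G : SecC n F V →ₗ[ℂ] Sec n F V}

/-- `G` is a propagator of `D` with supports spreading along the relation `r`. -/
structure IsGreen (r : M → M → Prop) (D : Sec n F V →ₗ[ℂ] Sec n F V)
    (G : SecC n F V →ₗ[ℂ] Sec n F V) : Prop where
  apply_green : ∀ f : SecC n F V, D (G f) = f
  green_apply : ∀ f f' : SecC n F V, D f = f' → G f' = f
  secSupp_subset : ∀ f : SecC n F V, secSupp (G f) ⊆ fut r (secSupp f.1)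

/-- Multiply by a smooth function that is 1 on the future of `C` and 0 on its past, away from a
compact neighbourhood `N` of their intersection; adding `N` to `C` absorbs the transition region. -/
theorem secSupp_decomposition (hr : IsCausalRel r) {u : Sec n F V} {C : Set M} (hC : IsCompact C)
    (hu : secSupp u ⊆ fut r C ∪ fut (fun p q => r q p) C) :
    ∃ C', IsCompact C' ∧ ∃ v w : Sec n F V, u = v + w ∧ secSupp v ⊆ fut r C' ∧
      secSupp w ⊆ fut (fun p q => r q p) C' := by
  have : LocallyCompactSpace M := ChartedSpace.locallyCompactSpace (EuclideanSpace ℝ (Fin n)) M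
  set A := fut r C
  set B := fut (fun p q => r q p) C
  have hA : IsClosed A := hr.isClosed_fut hC
  have hB : IsClosed B := hr.swap.isClosed_fut hC
  obtain ⟨N, hN, hABN⟩ := exists_compact_superset (hr.isCompact_fut_inter hC hC)
  obtain ⟨f, hf0, hf1, -⟩ := exists_contMDiffMap_zero_one_of_isClosed (n := (⊤ : ℕ∞)) (𝓡 n)
    (hB.sdiff isOpen_interior) (hA.sdiff isOpen_interior) (Set.disjoint_left.2 fun x hxB hxA =>
      hxA.2 (hABN ⟨hxA.1, hxB.1⟩))
  have hf : ContMDiff (𝓡 n) 𝓘(ℝ, ℂ) ∞ fun x => (f x : ℂ) :=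
    Complex.ofRealCLM.contDiff.contMDiff.comp f.contMDiff
  have hzero : ∀ x, x ∉ A → x ∉ B → u.1 x = 0 := fun x hxA hxB =>
    eq_zero_of_notMem_secSupp fun hx => (hu hx).elim hxA hxB
  refine ⟨C ∪ N, hC.union hN, mulSec _ hf u, u - mulSec _ hf u, by abel, ?_, ?_⟩
  · refine (secSupp_subset_of_isClosed (hA.union hN.isClosed) fun x hx => ?_).trans
      (Set.union_subset (hr.fut_subset_fut fun c hc => hr.subset_fut _ (Or.inl hc))
        fun c hc => hr.subset_fut _ (Or.inr hc))
    rw [Set.mem_union, not_or] at hx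
    change (f x : ℂ) • u.1 x = 0
    by_cases hxB : x ∈ B
    · rw [hf0 ⟨hxB, fun h => hx.2 (interior_subset h)⟩, Pi.zero_apply, Complex.ofReal_zero,
        zero_smul]
    · rw [hzero x hx.1 hxB, smul_zero]
  · refine (secSupp_subset_of_isClosed (hB.union hN.isClosed) fun x hx => ?_).trans
      (Set.union_subset (hr.swap.fut_subset_fut fun c hc => hr.swap.subset_fut _ (Or.inl hc))
        fun c hc => hr.swap.subset_fut _ (Or.inr hc))
    rw [Set.mem_union, not_or] at hx
    change u.1 x - (f x : ℂ) • u.1 x = 0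
    by_cases hxA : x ∈ A
    · rw [hf1 ⟨hxA, fun h => hx.2 (interior_subset h)⟩, Pi.one_apply, Complex.ofReal_one, one_smul,
        sub_self]
    · rw [hzero x hxA hx.1, smul_zero, sub_zero]

/-- The source `s` need not have compact support, but the solution before `q` depends only on `s` in
the past of `q`, which meets `fut r C` in a compact set. Cut off there, apply `G`, and glue the
results over varying `q`. -/
theorem IsGreen.exists_preimage (hr : IsCausalRel r) (hD : IsLocalOp D) (hG : IsGreen r D G)
    {s : Sec n F V} {C : Set M} (hC : IsCompact C) (hs : secSupp s ⊆ fut r C) :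
    ∃ u, D u = s ∧ secSupp u ⊆ fut r C := by
  have hcut : ∀ q : M, ∃ v : SecC n F V, secSupp v.1 ⊆ secSupp s ∧
      ∀ y ∈ fut r C, r y q → ∀ᶠ z in 𝓝 y, v.1.1 z = s.1 z := by
    intro q
    obtain ⟨f, hf, h1, t, ht, h0⟩ := exists_complex_cutoff n
      (hr.isCompact_fut_inter hC (isCompact_singleton (x := q)))
    refine ⟨⟨mulSec f hf s, mulSec_mem_secC hf s ht h0⟩, secSupp_mulSec_subset f hf s,
      fun y hy hyq => ?_⟩
    have hyN : y ∈ fut r C ∩ fut (fun p q => r q p) {q} := ⟨hy, q, rfl, hyq⟩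
    filter_upwards [h1.filter_mono (nhds_le_nhdsSet hyN)] with z hz
    change f z • s.1 z = s.1 z
    rw [hz, one_smul]
  choose v hvs hv using hcut
  -- The two truncated sources coincide near every point of `fut r C` that precedes `x`, so the
  -- solution of their difference is not supported at `x`.
  have hagree : ∀ q q' x, r x q → r x q' → (G (v q)).1 x = (G (v q')).1 x := by
    intro q q' x hq hq'
    have hx : x ∉ secSupp (G (v q - v q')) := by
      intro hx
      obtain ⟨y, hy, hyx⟩ := hG.secSupp_subset _ hx
      have hyC : y ∈ fut r C := hs ((secSupp_sub (v q).1 (v q').1 hy).elim (fun h => hvs q h)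
        fun h => hvs q' h)
      refine notMem_secSupp.2 ?_ hy
      filter_upwards [hv q y hyC (hr.trans _ _ _ hyx hq), hv q' y hyC (hr.trans _ _ _ hyx hq')]
        with z hz hz'
      change (v q).1.1 z - (v q').1.1 z = 0
      rw [hz, hz', sub_self]
    have h := eq_zero_of_notMem_secSupp hx
    have e : G (v q - v q') = G (v q) - G (v q') := map_sub G _ _
    rw [e] at h
    exact sub_eq_zero.1 h
  -- The past of `q x` is a neighbourhood of `x`, so the single section `G (v (q x))` describes the
  -- glued solution near `x`, which gives smoothness and the equation.
  choose q _ hq using fun x => hr.exists_future x Set.univ Filter.univ_mem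
  have hself : ∀ x, r x (q x) := fun x =>
    show x ∈ {y | r y (q x)} from mem_of_mem_nhds (hq x)
  have hnear : ∀ x, ∀ᶠ y in 𝓝 x, (G (v (q y))).1 y = (G (v (q x))).1 y := fun x => by
    filter_upwards [hq x] with y hy
    exact hagree _ _ y (hself y) hy
  let u : Sec n F V := ⟨fun x => (G (v (q x))).1 x, fun x => by
    refine ((G (v (q x))).2 x).congr_of_eventuallyEq ?_
    filter_upwards [hnear x] with y hy
    rw [hy]⟩
  refine ⟨u, ?_, secSupp_subset_of_isClosed (hr.isClosed_fut hC) fun x hx => ?_⟩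
  · ext x
    rw [hD.congr (u := u) (v := G (v (q x))) (hnear x), hG.apply_green]
    by_cases hx : x ∈ secSupp s
    · exact (hv (q x) x (hs hx) (hself x)).self_of_nhds
    · rw [eq_zero_of_notMem_secSupp hx, eq_zero_of_notMem_secSupp fun h => hx (hvs _ h)]
  · refine eq_zero_of_notMem_secSupp (u := G (v (q x))) fun h => hx ?_
    exact hr.fut_subset_fut ((hvs _).trans hs) (hG.secSupp_subset _ h)

variable [MeasurableSpace M] [BorelSpace M]

/-- Formally `(u|φ) = (u|D'w) = (Du|w) = 0` with `w = Gφ`. As `w` spreads in the direction opposite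
to `u`, the two supports meet in a compact set, and a cutoff equal to 1 near it reduces the
integration by parts to compactly supported sections. -/
theorem IsGreen.eq_zero_of_adjoint [ContMDiffVectorBundle ∞ F V (𝓡 n)]
    (g : LorentzianStructure n M) (h : HermitianStructure n F V) (hr : IsCausalRel r)
    (hD : IsLocalOp D) {D' : Sec n F V →ₗ[ℂ] Sec n F V} (hD' : IsLocalOp D')
    (hadj : ∀ u ∈ SecC n F V, ∀ v ∈ SecC n F V, pairing g h (D u) v = pairing g h u (D' v))
    (hG : IsGreen (fun p q => r q p) D' G) {u : Sec n F V} {C : Set M} (hC : IsCompact C)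
    (hu : secSupp u ⊆ fut r C) (hDu : D u = 0) : u = 0 := by
  refine eq_zero_of_pairing_eq_zero g h fun φ hφ => ?_
  set w := G ⟨φ, hφ⟩
  have hw : D' w = φ := hG.apply_green ⟨φ, hφ⟩
  have hN : IsCompact (secSupp u ∩ secSupp w) :=
    (hr.isCompact_fut_inter hC hφ).of_isClosed_subset
      ((isClosed_secSupp u).inter (isClosed_secSupp w))
      (Set.inter_subset_inter hu (hG.secSupp_subset ⟨φ, hφ⟩))
  obtain ⟨f, hf, h1, t, ht, h0⟩ := exists_complex_cutoff n hN
  have hmul : ∀ x ∈ secSupp u ∩ secSupp w, ∀ v : Sec n F V,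
      ∀ᶠ y in 𝓝 x, (mulSec f hf v).1 y = v.1 y := by
    intro x hx v
    filter_upwards [h1.filter_mono (nhds_le_nhdsSet hx)] with y hy
    change f y • v.1 y = v.1 y
    rw [hy, one_smul]
  have hout : ∀ (v : Sec n F V) (x : M), x ∉ secSupp v → x ∉ secSupp (mulSec f hf v) :=
    fun v x hx hx' => hx (secSupp_mulSec_subset f hf v hx')
  -- The integrands agree pointwise: the cutoff is invisible near the common support, and elsewhere
  -- one factor vanishes on both sides.
  have e1 : pairing g h u φ = pairing g h (mulSec f hf u) (D' (mulSec f hf w)) := by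
    refine integral_congr_ae (Filter.Eventually.of_forall fun x => ?_)
    change h.form x (u.1 x) (φ.1 x) = h.form x ((mulSec f hf u).1 x) ((D' (mulSec f hf w)).1 x)
    by_cases hxu : x ∈ secSupp u
    · by_cases hxw : x ∈ secSupp w
      · rw [(hmul x ⟨hxu, hxw⟩ u).self_of_nhds, hD'.congr (hmul x ⟨hxu, hxw⟩ w), hw]
      · rw [hD' _ x (notMem_secSupp.1 (hout w x hxw)), ← hw, hD' w x (notMem_secSupp.1 hxw),
          map_zero, map_zero]
    · rw [eq_zero_of_notMem_secSupp hxu, eq_zero_of_notMem_secSupp (hout u x hxu), map_zero,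
        LinearMap.zero_apply, LinearMap.zero_apply]
  have e2 : pairing g h (D (mulSec f hf u)) (mulSec f hf w) = 0 := by
    refine integral_eq_zero_of_ae (Filter.Eventually.of_forall fun x => ?_)
    change h.form x ((D (mulSec f hf u)).1 x) ((mulSec f hf w).1 x) = 0
    by_cases hxu : x ∈ secSupp u
    · by_cases hxw : x ∈ secSupp w
      · rw [hD.congr (hmul x ⟨hxu, hxw⟩ u), hDu]
        exact LinearMap.map_zero₂ _ _
      · rw [eq_zero_of_notMem_secSupp (hout w x hxw), map_zero]
    · rw [hD _ x (notMem_secSupp.1 (hout u x hxu)), map_zero, LinearMap.zero_apply]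
  rw [e1, ← hadj _ (mulSec_mem_secC hf u ht h0) _ (mulSec_mem_secC hf w ht h0), e2]

end Propagators

/-! ### The exact sequence of a Green hyperbolic operator -/

section WellPosed

variable {n : ℕ} {M : Type*} [TopologicalSpace M] [ChartedSpace (EuclideanSpace ℝ (Fin n)) M]
  [IsManifold (𝓡 n) ∞ M] {g : LorentzianStructure n M}
  {F : Type*} [NormedAddCommGroup F] [NormedSpace ℂ F] {V : M → Type*}
  [∀ x, AddCommGroup (V x)] [∀ x, Module ℂ (V x)] [∀ x, TopologicalSpace (V x)]
  [TopologicalSpace (TotalSpace F V)] [FiberBundle F V] [VectorBundle ℂ F V]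
  {F' : Type*} [NormedAddCommGroup F'] [NormedSpace ℂ F'] {W : M → Type*}
  [∀ x, AddCommGroup (W x)] [∀ x, Module ℂ (W x)] [∀ x, TopologicalSpace (W x)]
  [TopologicalSpace (TotalSpace F' W)] [FiberBundle F' W] [VectorBundle ℂ F' W]
  {D : Sec n F V →ₗ[ℂ] Sec n F V} {E : Sec n F' W →ₗ[ℂ] Sec n F' W}

/-- `D` is local, its retarded and advanced propagators exist, and sections in the kernel of `D`
vanish if they are supported in the future or in the past of a compact set. -/
structure IsWellPosed (g : LorentzianStructure n M) (D : Sec n F V →ₗ[ℂ] Sec n F V) : Prop where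
  isLocalOp : IsLocalOp D
  ret : IsGreen g.CausalLE D (retarded g D)
  adv : IsGreen (fun p q => g.CausalLE q p) D (advanced g D)
  eq_zero_future : ∀ (u : Sec n F V) (C : Set M), IsCompact C → secSupp u ⊆ g.JPlus C → D u = 0 →
    u = 0
  eq_zero_past : ∀ (u : Sec n F V) (C : Set M), IsCompact C → secSupp u ⊆ g.JMinus C → D u = 0 →
    u = 0

/-- The default value of `formalAdjoint` is 0, so a nonzero value must be a genuine adjoint. -/
theorem isFormalAdjoint_formalAdjoint [MeasurableSpace M] {h : HermitianStructure n F V}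
    {k : HermitianStructure n F' W} {A : Sec n F V →ₗ[ℂ] Sec n F' W}
    (hA : formalAdjoint g h k A ≠ 0) : IsFormalAdjoint g h k A (formalAdjoint g h k A) := by
  unfold formalAdjoint at hA ⊢
  split_ifs at hA ⊢ with hex
  · exact hex.choose_spec
  · exact absurd rfl hA

theorem IsRetarded.ne_zero {G : SecC n F V →ₗ[ℂ] Sec n F V} (hG : IsRetarded g D G)
    (hne : ∃ f ∈ SecC n F V, f ≠ 0) : D ≠ 0 := by
  rintro rfl
  obtain ⟨f, hf, hf0⟩ := hne
  exact hf0 (hG.1 ⟨f, hf⟩).symm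

theorem isRetarded_retarded (hD : ∃ G, IsRetarded g D G) : IsRetarded g D (retarded g D) := by
  rw [retarded, dif_pos hD]
  exact hD.choose_spec

theorem isAdvanced_advanced (hD : ∃ G, IsAdvanced g D G) : IsAdvanced g D (advanced g D) := by
  rw [advanced, dif_pos hD]
  exact hD.choose_spec

/-- Having a propagator forces `formalAdjoint g h h D` to be nonzero once there is a nonzero test
section, so it is a true adjoint. Its advanced propagator gives uniqueness towards the future, its
retarded one towards the past. -/
theorem GreenHyperbolic.isWellPosed [T2Space M] [SecondCountableTopology M] [MeasurableSpace M]
    [BorelSpace M] [ContMDiffVectorBundle ∞ F V (𝓡 n)] {h : HermitianStructure n F V}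
    (hg : g.GloballyHyperbolic) (hD : GreenHyperbolic g h D) (hloc : IsLocalOp D)
    (hne : ∃ f ∈ SecC n F V, f ≠ 0) : IsWellPosed g D := by
  obtain ⟨h1, h2, ⟨G₁, h3⟩, ⟨G₂, h4⟩⟩ := hD
  obtain ⟨hdiff, hadj⟩ := isFormalAdjoint_formalAdjoint (h3.ne_zero hne)
  have hr := LorentzianStructure.isCausalRel hg
  obtain ⟨r1, r2, r3⟩ := isRetarded_retarded h1
  obtain ⟨a1, a2, a3⟩ := isAdvanced_advanced h2
  exact
    { isLocalOp := hloc
      ret := ⟨r1, r2, r3⟩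
      adv := ⟨a1, a2, a3⟩
      eq_zero_future := fun u C hC hu hDu =>
        IsGreen.eq_zero_of_adjoint g h hr hloc hdiff.isLocalOp hadj ⟨h4.1, h4.2.1, h4.2.2⟩ hC hu hDu
      eq_zero_past := fun u C hC hu hDu =>
        IsGreen.eq_zero_of_adjoint g h hr.swap hloc hdiff.isLocalOp hadj ⟨h3.1, h3.2.1, h3.2.2⟩ hC
          hu hDu }

namespace IsWellPosed

theorem causalPropagator_mem_secSC (hD : IsWellPosed g D) (f : SecC n F V) :
    causalPropagator g D f ∈ SecSC F V g :=
  ⟨secSupp f.1, f.2, (secSupp_sub _ _).trans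
    (Set.union_subset_union (hD.ret.secSupp_subset f) (hD.adv.secSupp_subset f))⟩

theorem apply_causalPropagator (hD : IsWellPosed g D) (f : SecC n F V) :
    D (causalPropagator g D f) = 0 := by
  rw [causalPropagator, LinearMap.sub_apply, map_sub, hD.ret.apply_green, hD.adv.apply_green,
    sub_self]

theorem causalPropagator_mapC (hD : IsWellPosed g D) (f : SecC n F V) :
    causalPropagator g D (hD.isLocalOp.mapC f) = 0 := by
  rw [causalPropagator, LinearMap.sub_apply, hD.ret.green_apply f _ rfl,
    hD.adv.green_apply f _ rfl, sub_self]

theorem mapC_injective (hD : IsWellPosed g D) : Function.Injective hD.isLocalOp.mapC := by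
  intro f f' h
  have h1 := hD.ret.green_apply f (hD.isLocalOp.mapC f) rfl
  have h2 := hD.ret.green_apply f' (hD.isLocalOp.mapC f) (congrArg Subtype.val h.symm)
  exact Subtype.ext (h1.symm.trans h2)

/-- Propagators intertwine local operators that intertwine the equations. -/
theorem map_causalPropagator (hD : IsWellPosed g D) (hE : IsWellPosed g E)
    {A B : Sec n F V →ₗ[ℂ] Sec n F' W} (hA : IsLocalOp A) (hB : IsLocalOp B)
    (h : E ∘ₗ A = B ∘ₗ D) (f : SecC n F V) :
    A (causalPropagator g D f) = causalPropagator g E (hB.mapC f) := by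
  have hE' : ∀ u, E (A u) = B (D u) := fun u => LinearMap.congr_fun h u
  -- Both terms solve the `E`-equation with source `B f` and are supported in the future of `supp
  -- f`.
  have hret : A (retarded g D f) - retarded g E (hB.mapC f) = 0 := by
    refine hE.eq_zero_future _ (secSupp f.1) f.2 ((secSupp_sub _ _).trans (Set.union_subset
      ((hA.secSupp_subset _).trans (hD.ret.secSupp_subset f)) ?_)) ?_
    · refine (hE.ret.secSupp_subset _).trans ?_
      rintro q ⟨p, hp, hpq⟩
      exact ⟨p, hB.secSupp_subset _ hp, hpq⟩
    · rw [map_sub, hE', hD.ret.apply_green, hE.ret.apply_green, IsLocalOp.coe_mapC, sub_self]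
  have hadv : A (advanced g D f) - advanced g E (hB.mapC f) = 0 := by
    refine hE.eq_zero_past _ (secSupp f.1) f.2 ((secSupp_sub _ _).trans (Set.union_subset
      ((hA.secSupp_subset _).trans (hD.adv.secSupp_subset f)) ?_)) ?_
    · refine (hE.adv.secSupp_subset _).trans ?_
      rintro q ⟨p, hp, hpq⟩
      exact ⟨p, hB.secSupp_subset _ hp, hpq⟩
    · rw [map_sub, hE', hD.adv.apply_green, hE.adv.apply_green, IsLocalOp.coe_mapC, sub_self]
  rw [causalPropagator, causalPropagator, LinearMap.sub_apply, LinearMap.sub_apply, map_sub,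
    sub_eq_zero.1 hret, sub_eq_zero.1 hadv]

variable [T2Space M]

/-- If the two propagators agree on `f`, their common value has support in the compact set `J⁺(supp
f) ∩ J⁻(supp f)` and is the preimage. -/
theorem exists_mapC_eq_of_causalPropagator_eq_zero (hg : g.GloballyHyperbolic)
    (hD : IsWellPosed g D) {f : SecC n F V} (hf : causalPropagator g D f = 0) :
    ∃ k, hD.isLocalOp.mapC k = f := by
  have h : retarded g D f = advanced g D f := sub_eq_zero.1 hf
  have hK := (LorentzianStructure.isCausalRel hg).isCompact_fut_inter f.2 f.2
  refine ⟨⟨retarded g D f, hK.of_isClosed_subset (isClosed_secSupp _)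
    (Set.subset_inter (hD.ret.secSupp_subset f) ?_)⟩, Subtype.ext (hD.ret.apply_green f)⟩
  rw [h]
  exact hD.adv.secSupp_subset f

variable [SecondCountableTopology M]

/-- Split `u = v + w` into future and past parts. Then `D v = -D w` is compactly supported, and by
uniqueness its retarded solution is `v` and its advanced one is `-w`. -/
theorem exists_causalPropagator_eq (hg : g.GloballyHyperbolic) (hD : IsWellPosed g D)
    {u : Sec n F V} (hu : u ∈ SecSC F V g) (hDu : D u = 0) : ∃ f, causalPropagator g D f = u := by
  have hr := LorentzianStructure.isCausalRel hg
  obtain ⟨C₀, hC₀, hu⟩ := hu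
  obtain ⟨C, hC, v, w, rfl, hv, hw⟩ := secSupp_decomposition hr hC₀ hu
  have hvw : D v = -D w := eq_neg_of_add_eq_zero_left (by rw [← map_add, hDu])
  have hsupp : secSupp (D v) ⊆ fut g.CausalLE C ∩ fut (fun p q => g.CausalLE q p) C := by
    refine Set.subset_inter ((hD.isLocalOp.secSupp_subset v).trans hv) ?_
    rw [hvw, ← map_neg]
    refine (hD.isLocalOp.secSupp_subset (-w)).trans ?_
    rw [← neg_one_smul ℂ w]
    exact (secSupp_smul _ w).trans hw
  let f : SecC n F V :=
    ⟨D v, (hr.isCompact_fut_inter hC hC).of_isClosed_subset (isClosed_secSupp _) hsupp⟩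
  have hret : retarded g D f - v = 0 := by
    refine hD.eq_zero_future _ C hC ((secSupp_sub _ _).trans (Set.union_subset
      ((hD.ret.secSupp_subset f).trans (hr.fut_subset_fut (hsupp.trans Set.inter_subset_left)))
      hv)) ?_
    rw [map_sub, hD.ret.apply_green, sub_self]
  have hadv : advanced g D f + w = 0 := by
    refine hD.eq_zero_past _ C hC ((secSupp_add _ _).trans (Set.union_subset
      ((hD.adv.secSupp_subset f).trans
        (hr.swap.fut_subset_fut (hsupp.trans Set.inter_subset_right))) hw)) ?_
    rw [map_add, hD.adv.apply_green, ← sub_neg_eq_add, ← hvw, sub_self]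
  refine ⟨f, ?_⟩
  rw [causalPropagator, LinearMap.sub_apply, sub_eq_zero.1 hret, eq_neg_of_add_eq_zero_left hadv,
    sub_neg_eq_add]

theorem exists_preimage_secSC (hg : g.GloballyHyperbolic) (hD : IsWellPosed g D) {s : Sec n F V}
    (hs : s ∈ SecSC F V g) : ∃ u ∈ SecSC F V g, D u = s := by
  have hr := LorentzianStructure.isCausalRel hg
  obtain ⟨C₀, hC₀, hs⟩ := hs
  obtain ⟨C, hC, v, w, rfl, hv, hw⟩ := secSupp_decomposition hr hC₀ hs
  obtain ⟨a, rfl, ha⟩ := hD.ret.exists_preimage hr hD.isLocalOp hC hv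
  obtain ⟨b, rfl, hb⟩ := hD.adv.exists_preimage hr.swap hD.isLocalOp hC hw
  exact ⟨a + b, ⟨C, hC, (secSupp_add a b).trans (Set.union_subset_union ha hb)⟩, map_add D a b⟩

end IsWellPosed

theorem exists_ne_zero_mem_secC [T2Space M] [SecondCountableTopology M]
    [ContMDiffVectorBundle ∞ F V (𝓡 n)] {u : Sec n F V} (hu : u ≠ 0) :
    ∃ f ∈ SecC n F V, f ≠ 0 := by
  obtain ⟨x, hx⟩ : ∃ x, u.1 x ≠ 0 := by
    by_contra! h
    exact hu (Subtype.ext (funext h))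
  obtain ⟨f, hf, hfx⟩ := exists_mem_secC_apply_eq (n := n) (F := F) x (u.1 x)
  refine ⟨f, hf, ?_⟩
  rintro rfl
  exact hx hfx.symm

end WellPosed

/-- The two directions of `hiff` give well-definedness and injectivity on the quotients. -/
theorem inducesBijection_of_forall {X Y : Type*} [AddCommGroup X] [Module ℂ X] [AddCommGroup Y]
    [Module ℂ Y] {S : Submodule ℂ X} {G : S →ₗ[ℂ] Y} {E₁ F₁ : Submodule ℂ X}
    {E₂ F₂ : Submodule ℂ Y} (h₁ : F₁ ≤ E₁) (h₂ : F₂ ≤ E₂) (hS : E₁ ≤ S)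
    (hmap : ∀ u : S, u.1 ∈ E₁ → G u ∈ E₂)
    (hiff : ∀ u : S, u.1 ∈ E₁ → (G u ∈ F₂ ↔ u.1 ∈ F₁))
    (hsurj : ∀ v ∈ E₂, ∃ u : S, u.1 ∈ E₁ ∧ v - G u ∈ F₂) :
    InducesBijection G E₁ F₁ E₂ F₂ := by
  let L : E₁ →ₗ[ℂ] E₂ := (G ∘ₗ Submodule.inclusion hS).codRestrict E₂ fun u => hmap _ u.2
  have hL : ∀ u : E₁, (L u ∈ F₂.submoduleOf E₂ ↔ u ∈ F₁.submoduleOf E₁) := fun u =>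
    hiff (Submodule.inclusion hS u) u.2
  let φ := (F₁.submoduleOf E₁).mapQ (F₂.submoduleOf E₂) L fun u hu => (hL u).2 hu
  refine ⟨h₁, h₂, hS, φ, fun u => ⟨hmap _ u.2, rfl⟩, ?_, ?_⟩
  · rw [injective_iff_map_eq_zero]
    intro a
    obtain ⟨u, rfl⟩ := Submodule.Quotient.mk_surjective _ a
    intro hu
    change Submodule.Quotient.mk (L u) = 0 at hu
    rw [Submodule.Quotient.mk_eq_zero, hL] at hu
    rwa [Submodule.Quotient.mk_eq_zero]
  · intro b
    obtain ⟨v, rfl⟩ := Submodule.Quotient.mk_surjective _ b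
    obtain ⟨u, hu, huv⟩ := hsurj v v.2
    refine ⟨Submodule.Quotient.mk ⟨u.1, hu⟩, ?_⟩
    change Submodule.Quotient.mk (L ⟨u.1, hu⟩) = _
    rw [eq_comm, Submodule.Quotient.eq]
    exact huv

/-! ### Gauge theories: the two bijections -/

section HackSchenkel

variable {n : ℕ} {M : Type*} [TopologicalSpace M] [ChartedSpace (EuclideanSpace ℝ (Fin n)) M]
  [IsManifold (𝓡 n) ∞ M] [T2Space M] [SecondCountableTopology M] {g : LorentzianStructure n M}
  {F₀ : Type*} [NormedAddCommGroup F₀] [NormedSpace ℂ F₀] {V₀ : M → Type*}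
  [∀ x, AddCommGroup (V₀ x)] [∀ x, Module ℂ (V₀ x)] [∀ x, TopologicalSpace (V₀ x)]
  [TopologicalSpace (TotalSpace F₀ V₀)] [FiberBundle F₀ V₀] [VectorBundle ℂ F₀ V₀]
  {F₁ : Type*} [NormedAddCommGroup F₁] [NormedSpace ℂ F₁] {V₁ : M → Type*}
  [∀ x, AddCommGroup (V₁ x)] [∀ x, Module ℂ (V₁ x)] [∀ x, TopologicalSpace (V₁ x)]
  [TopologicalSpace (TotalSpace F₁ V₁)] [FiberBundle F₁ V₁] [VectorBundle ℂ F₁ V₁]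
  {P : Sec n F₁ V₁ →ₗ[ℂ] Sec n F₁ V₁} {K T : Sec n F₀ V₀ →ₗ[ℂ] Sec n F₁ V₁}
  {Kst : Sec n F₁ V₁ →ₗ[ℂ] Sec n F₀ V₀} {D : Sec n F₁ V₁ →ₗ[ℂ] Sec n F₁ V₁}

/-- The properties of a linear gauge theory with gauge fixing that do not mention the hermitian
structures. -/
structure IsGaugeFixed (g : LorentzianStructure n M) (P : Sec n F₁ V₁ →ₗ[ℂ] Sec n F₁ V₁)
    (K T : Sec n F₀ V₀ →ₗ[ℂ] Sec n F₁ V₁) (Kst : Sec n F₁ V₁ →ₗ[ℂ] Sec n F₀ V₀)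
    (D : Sec n F₁ V₁ →ₗ[ℂ] Sec n F₁ V₁) : Prop where
  isLocalOp_P : IsLocalOp P
  isLocalOp_K : IsLocalOp K
  isLocalOp_T : IsLocalOp T
  isLocalOp_Kst : IsLocalOp Kst
  apply_D : ∀ u, D u = P u + T (Kst u)
  P_K : ∀ u, P (K u) = 0
  Kst_P : ∀ u, Kst (P u) = 0
  wellPosed_R : IsWellPosed g (Kst ∘ₗ K)
  wellPosed_Q : IsWellPosed g (Kst ∘ₗ T)
  wellPosed_D : IsWellPosed g D

/-- If `P` is formally self-adjoint and `P K = 0`, then `K* P = 0`. -/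
theorem formalAdjoint_comp_eq_zero [MeasurableSpace M] [BorelSpace M]
    [ContMDiffVectorBundle ∞ F₀ V₀ (𝓡 n)] {h₀ : HermitianStructure n F₀ V₀}
    {h₁ : HermitianStructure n F₁ V₁} (hP : IsLocalOp P) (hK : IsLocalOp K)
    (hPP : ∀ u ∈ SecC n F₁ V₁, ∀ v ∈ SecC n F₁ V₁, pairing g h₁ (P u) v = pairing g h₁ u (P v))
    (hKst : IsFormalAdjoint g h₀ h₁ K Kst) (hPK : ∀ u, P (K u) = 0) (v : Sec n F₁ V₁) :
    Kst (P v) = 0 := by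
  have hloc := hKst.1.isLocalOp
  -- The pairing argument needs compact supports; locality then extends the identity to all
  -- sections.
  have hc : ∀ v ∈ SecC n F₁ V₁, Kst (P v) = 0 := by
    intro v hv
    refine eq_zero_of_pairing_eq_zero g h₀ fun u hu => ?_
    rw [← conj_pairing, ← hKst.2 u hu _ (hP.map_mem_secC hv), ← hPP _ (hK.map_mem_secC hu) v hv,
      hPK]
    have : pairing g h₁ 0 v = 0 := by
      refine integral_eq_zero_of_ae (Filter.Eventually.of_forall fun x => ?_)
      exact LinearMap.map_zero₂ (h₁.form x) (v.1 x)
    rw [this, map_zero]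
  ext x
  obtain ⟨f, hf, h1, t, ht, h0⟩ := exists_complex_cutoff n (isCompact_singleton (x := x))
  have hcongr := (hP.comp hloc).congr (u := v) (v := mulSec f hf v) (x := x) (by
    filter_upwards [h1.filter_mono (nhds_le_nhdsSet (Set.mem_singleton x))] with y hy
    change v.1 y = f y • v.1 y
    rw [hy, one_smul])
  refine hcongr.trans ?_
  rw [LinearMap.comp_apply, hc _ (mulSec_mem_secC hf v ht h0)]

theorem HackSchenkel.isGaugeFixed [MeasurableSpace M] [BorelSpace M]
    [ContMDiffVectorBundle ∞ F₀ V₀ (𝓡 n)] [ContMDiffVectorBundle ∞ F₁ V₁ (𝓡 n)]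
    {h₀ : HermitianStructure n F₀ V₀} {h₁ : HermitianStructure n F₁ V₁}
    (hg : g.GloballyHyperbolic) (hyp : HackSchenkel g h₀ h₁ P K T) :
    IsGaugeFixed g P K T (formalAdjoint g h₀ h₁ K) (P + T ∘ₗ formalAdjoint g h₀ h₁ K) := by
  -- `K ≠ 0` provides nonzero test sections of both bundles, which exclude default adjoints.
  obtain ⟨u, hu⟩ : ∃ u, K u ≠ 0 := by
    by_contra! h
    exact hyp.K_ne_zero (LinearMap.ext h)
  have hne₁ := exists_ne_zero_mem_secC hu
  have hne₀ := exists_ne_zero_mem_secC (u := u) (by rintro rfl; exact hu (map_zero K))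
  have hKst : IsFormalAdjoint g h₀ h₁ K (formalAdjoint g h₀ h₁ K) := by
    refine isFormalAdjoint_formalAdjoint fun h => ?_
    obtain ⟨G, hG⟩ := hyp.green_R.1
    exact hG.ne_zero hne₀ (by rw [h, LinearMap.zero_comp])
  have hP := hyp.diffOp_P.isLocalOp
  have hK := hyp.diffOp_K.isLocalOp
  have hT := hyp.diffOp_T.isLocalOp
  have hloc := hKst.1.isLocalOp
  have hPK : ∀ u, P (K u) = 0 := fun u => LinearMap.congr_fun hyp.P_comp_K u
  have hPP : ∀ u ∈ SecC n F₁ V₁, ∀ v ∈ SecC n F₁ V₁,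
      pairing g h₁ (P u) v = pairing g h₁ u (P v) := by
    -- For `P = 0` the equality `formalAdjoint P = P` could come from the default value, but
    -- symmetry is then trivial.
    by_cases h : P = 0
    · rw [h]
      intro u _ v _
      rw [LinearMap.zero_apply, LinearMap.zero_apply]
      refine integral_congr_ae (Filter.Eventually.of_forall fun x => ?_)
      change h₁.form x 0 (v.1 x) = h₁.form x (u.1 x) 0
      rw [LinearMap.map_zero₂, map_zero]
    · have h' := isFormalAdjoint_formalAdjoint (g := g) (h := h₁) (k := h₁) (A := P)
        (by rwa [hyp.selfAdjoint_P])
      rw [hyp.selfAdjoint_P] at h'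
      exact h'.2
  exact
    { isLocalOp_P := hP
      isLocalOp_K := hK
      isLocalOp_T := hT
      isLocalOp_Kst := hloc
      apply_D := fun u => rfl
      P_K := hPK
      Kst_P := formalAdjoint_comp_eq_zero hP hK hPP hKst hPK
      wellPosed_R := hyp.green_R.isWellPosed hg (hK.comp hloc) hne₀
      wellPosed_Q := hyp.green_Q.isWellPosed hg (hT.comp hloc) hne₀
      wellPosed_D := hyp.green_D.isWellPosed hg (hP.add (hloc.comp hT)) hne₁ }

namespace IsGaugeFixed

omit [T2Space M] [SecondCountableTopology M] in
-- Since `K*P = 0`, `K*D = QK*`.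
theorem Kst_causalPropagator (H : IsGaugeFixed g P K T Kst D) (f : SecC n F₁ V₁) :
    Kst (causalPropagator g D f) =
      causalPropagator g (Kst ∘ₗ T) (H.isLocalOp_Kst.mapC f) :=
  H.wellPosed_D.map_causalPropagator H.wellPosed_Q H.isLocalOp_Kst H.isLocalOp_Kst
    (LinearMap.ext fun u => by
      simp only [LinearMap.comp_apply, H.apply_D, map_add, H.Kst_P, zero_add]) f

omit [T2Space M] [SecondCountableTopology M] in
-- Since `PK = 0`, `DK = TR`.
theorem K_causalPropagator (H : IsGaugeFixed g P K T Kst D) (f : SecC n F₀ V₀) :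
    K (causalPropagator g (Kst ∘ₗ K) f) = causalPropagator g D (H.isLocalOp_T.mapC f) :=
  H.wellPosed_R.map_causalPropagator H.wellPosed_D H.isLocalOp_K H.isLocalOp_T
    (LinearMap.ext fun u => by
      simp only [LinearMap.comp_apply, H.apply_D, H.P_K, zero_add]) f

omit [T2Space M] [SecondCountableTopology M] in
theorem Kst_causalPropagator_eq_zero (H : IsGaugeFixed g P K T Kst D) {f : SecC n F₁ V₁}
    (hf : Kst f = 0) : Kst (causalPropagator g D f) = 0 := by
  rw [H.Kst_causalPropagator, show H.isLocalOp_Kst.mapC f = 0 from Subtype.ext hf, map_zero]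

omit [T2Space M] [SecondCountableTopology M] in
/-- `G_D P = -G_D T K*` on compactly supported sections. -/
theorem causalPropagator_mapC_P (H : IsGaugeFixed g P K T Kst D) (k : SecC n F₁ V₁) :
    causalPropagator g D (H.isLocalOp_P.mapC k) =
      causalPropagator g D (H.isLocalOp_T.mapC (-H.isLocalOp_Kst.mapC k)) := by
  have h : H.wellPosed_D.isLocalOp.mapC k =
      H.isLocalOp_P.mapC k + H.isLocalOp_T.mapC (H.isLocalOp_Kst.mapC k) :=
    Subtype.ext (H.apply_D k)
  have h0 := H.wellPosed_D.causalPropagator_mapC k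
  rw [h, map_add] at h0
  have h1 : causalPropagator g D (H.isLocalOp_T.mapC (-H.isLocalOp_Kst.mapC k)) =
      -causalPropagator g D (H.isLocalOp_T.mapC (H.isLocalOp_Kst.mapC k)) :=
    map_neg (causalPropagator g D ∘ₗ H.isLocalOp_T.mapC) _
  rw [h1]
  exact eq_neg_of_add_eq_zero_left h0

omit [SecondCountableTopology M] in
-- The common core of both injectivity proofs: `f - Tq = Dk`, and applying `K*` with injectivity of
-- `Q` on compact supports forces `K*k = -q`, so the `T`-terms cancel.
theorem exists_mapC_P_eq (hg : g.GloballyHyperbolic) (H : IsGaugeFixed g P K T Kst D)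
    {f : SecC n F₁ V₁} (hf : Kst f = 0) {q : SecC n F₀ V₀}
    (hq : causalPropagator g D f = causalPropagator g D (H.isLocalOp_T.mapC q)) :
    ∃ k, H.isLocalOp_P.mapC k = f := by
  obtain ⟨k, hk⟩ := H.wellPosed_D.exists_mapC_eq_of_causalPropagator_eq_zero hg
    (f := f - H.isLocalOp_T.mapC q)
    ((map_sub (causalPropagator g D) f _).trans (sub_eq_zero.2 hq))
  have hk' : P k + T (Kst k) = f - T q := (H.apply_D k).symm.trans (congrArg Subtype.val hk)
  have h1 : Kst (T (Kst k)) = Kst (T (-q)) := by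
    have := congrArg Kst hk'
    rwa [map_add, H.Kst_P, zero_add, map_sub, hf, zero_sub, ← map_neg, ← map_neg] at this
  have h2 : H.isLocalOp_Kst.mapC k = -q := H.wellPosed_Q.mapC_injective (Subtype.ext h1)
  refine ⟨k, Subtype.ext ?_⟩
  have h3 : Kst k = -q := congrArg Subtype.val h2
  rw [h3, map_neg] at hk'
  have h4 := congrArg (· + T q) hk'
  simpa using h4

/-- The common core of both surjectivity proofs: `G_Q K*f = 0` gives `K*f = Qq`, and subtracting
`Tq` from `f` restores the constraint. -/
theorem exists_causalPropagator_eq (hg : g.GloballyHyperbolic) (H : IsGaugeFixed g P K T Kst D)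
    {u : Sec n F₁ V₁} (hu : u ∈ SecSC F₁ V₁ g) (hDu : D u = 0) (hKu : Kst u = 0) :
    ∃ f : SecC n F₁ V₁, Kst f = 0 ∧ ∃ q : SecC n F₀ V₀,
      u = causalPropagator g D f + causalPropagator g D (H.isLocalOp_T.mapC q) := by
  obtain ⟨f, rfl⟩ := H.wellPosed_D.exists_causalPropagator_eq hg hu hDu
  rw [H.Kst_causalPropagator] at hKu
  obtain ⟨q, hq⟩ := H.wellPosed_Q.exists_mapC_eq_of_causalPropagator_eq_zero hg hKu
  have hq' : Kst (T q) = Kst f := congrArg Subtype.val hq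
  refine ⟨f - H.isLocalOp_T.mapC q, ?_, q, ?_⟩
  · rw [Submodule.coe_sub, map_sub, IsLocalOp.coe_mapC, hq', sub_self]
  · exact (sub_add_cancel _ _).symm.trans
      (congrArg (· + _) (map_sub (causalPropagator g D) f (H.isLocalOp_T.mapC q)).symm)

omit [T2Space M] [SecondCountableTopology M] in
theorem map_P_le (H : IsGaugeFixed g P K T Kst D) :
    (SecC n F₁ V₁).map P ≤ LinearMap.ker Kst ⊓ SecC n F₁ V₁ := by
  rintro _ ⟨k, hk, rfl⟩
  exact ⟨H.Kst_P k, H.isLocalOp_P.map_mem_secC hk⟩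

theorem inducesBijection_ker_P (hg : g.GloballyHyperbolic) (H : IsGaugeFixed g P K T Kst D) :
    InducesBijection (causalPropagator g D)
      (LinearMap.ker Kst ⊓ SecC n F₁ V₁) ((SecC n F₁ V₁).map P)
      (LinearMap.ker P ⊓ SecSC F₁ V₁ g) ((SecSC F₀ V₀ g).map K) := by
  refine inducesBijection_of_forall H.map_P_le ?_ inf_le_right ?_ ?_ ?_
  · rintro _ ⟨h, hh, rfl⟩
    exact ⟨H.P_K h, H.isLocalOp_K.map_mem_secSC hh⟩
  · rintro f ⟨hf, -⟩
    refine ⟨?_, H.wellPosed_D.causalPropagator_mem_secSC f⟩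
    have h := H.wellPosed_D.apply_causalPropagator f
    rwa [H.apply_D, H.Kst_causalPropagator_eq_zero hf, map_zero, add_zero] at h
  · rintro f ⟨hf, -⟩
    constructor
    · rintro ⟨h, hh, hhf⟩
      -- This makes `h` equal to some `G_R q`, so `K h = G_D T q`.
      have hR : (Kst ∘ₗ K) h = 0 := by
        rw [LinearMap.comp_apply, hhf, H.Kst_causalPropagator_eq_zero hf]
      obtain ⟨q, rfl⟩ := H.wellPosed_R.exists_causalPropagator_eq hg hh hR
      rw [H.K_causalPropagator] at hhf
      obtain ⟨k, hk⟩ := H.exists_mapC_P_eq hg hf hhf.symm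
      exact ⟨k, k.2, congrArg Subtype.val hk⟩
    · rintro ⟨k, hk, hkf⟩
      have e : f = H.isLocalOp_P.mapC ⟨k, hk⟩ := Subtype.ext hkf.symm
      rw [e, H.causalPropagator_mapC_P, ← H.K_causalPropagator]
      exact ⟨_, H.wellPosed_R.causalPropagator_mem_secSC _, rfl⟩
  · rintro v ⟨hPv, hv⟩
    -- Gauge fixing: solving `R h = K*v` lets `v` be replaced by `v - K h`, which satisfies `K* = 0`
    -- and therefore `D = 0`.
    obtain ⟨h, hh, hKh⟩ :=
      H.wellPosed_R.exists_preimage_secSC hg (H.isLocalOp_Kst.map_mem_secSC hv)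
    have hK0 : Kst (v - K h) = 0 := by
      rw [map_sub, ← hKh, LinearMap.comp_apply, sub_self]
    have hD0 : D (v - K h) = 0 := by
      rw [H.apply_D, hK0, map_zero, add_zero, map_sub, H.P_K, sub_zero]
      exact hPv
    obtain ⟨f, hf, q, hq⟩ := H.exists_causalPropagator_eq hg
      (sub_mem hv (H.isLocalOp_K.map_mem_secSC hh)) hD0 hK0
    refine ⟨f, ⟨hf, f.2⟩, causalPropagator g (Kst ∘ₗ K) q + h,
      add_mem (H.wellPosed_R.causalPropagator_mem_secSC q) hh, ?_⟩
    rw [map_add, H.K_causalPropagator, sub_eq_iff_eq_add.1 hq]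
    abel

omit [T2Space M] [SecondCountableTopology M] in
theorem mem_map_T_iff (H : IsGaugeFixed g P K T Kst D) {u : Sec n F₁ V₁} :
    u ∈ (((SecC n F₀ V₀).map T).submoduleOf (SecC n F₁ V₁)).map (causalPropagator g D) ↔
      ∃ q, causalPropagator g D (H.isLocalOp_T.mapC q) = u := by
  constructor
  · rintro ⟨f, ⟨q, hq, hqf⟩, rfl⟩
    exact ⟨⟨q, hq⟩, congrArg _ (Subtype.ext hqf)⟩
  · rintro ⟨q, rfl⟩
    exact ⟨_, ⟨q, q.2, rfl⟩, rfl⟩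

theorem inducesBijection_ker_D (hg : g.GloballyHyperbolic) (H : IsGaugeFixed g P K T Kst D) :
    InducesBijection (causalPropagator g D)
      (LinearMap.ker Kst ⊓ SecC n F₁ V₁) ((SecC n F₁ V₁).map P)
      (LinearMap.ker D ⊓ LinearMap.ker Kst ⊓ SecSC F₁ V₁ g)
      ((((SecC n F₀ V₀).map T).submoduleOf (SecC n F₁ V₁)).map (causalPropagator g D)) := by
  refine inducesBijection_of_forall H.map_P_le ?_ inf_le_right ?_ ?_ ?_
  · intro u hu
    obtain ⟨q, rfl⟩ := H.mem_map_T_iff.1 hu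
    refine ⟨⟨H.wellPosed_D.apply_causalPropagator _, ?_⟩,
      H.wellPosed_D.causalPropagator_mem_secSC _⟩
    exact (H.Kst_causalPropagator _).trans (H.wellPosed_Q.causalPropagator_mapC q)
  · rintro f ⟨hf, -⟩
    exact ⟨⟨H.wellPosed_D.apply_causalPropagator f, H.Kst_causalPropagator_eq_zero hf⟩,
      H.wellPosed_D.causalPropagator_mem_secSC f⟩
  · rintro f ⟨hf, -⟩
    rw [H.mem_map_T_iff]
    constructor
    · rintro ⟨q, hq⟩
      obtain ⟨k, hk⟩ := H.exists_mapC_P_eq hg hf hq.symm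
      exact ⟨k, k.2, congrArg Subtype.val hk⟩
    · rintro ⟨k, hk, hkf⟩
      have e : f = H.isLocalOp_P.mapC ⟨k, hk⟩ := Subtype.ext hkf.symm
      exact ⟨_, by rw [e, H.causalPropagator_mapC_P]⟩
  · rintro v ⟨⟨hDv, hKv⟩, hv⟩
    obtain ⟨f, hf, q, hq⟩ := H.exists_causalPropagator_eq hg hv hDv hKv
    exact ⟨f, ⟨hf, f.2⟩, H.mem_map_T_iff.2 ⟨q, by rw [hq, add_sub_cancel_left]⟩⟩

end IsGaugeFixed

end HackSchenkel

end LinearGaugeTheory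

theorem mainTheorem7 {n : ℕ} {M : Type*} [TopologicalSpace M]
    [ChartedSpace (EuclideanSpace ℝ (Fin n)) M] [IsManifold (𝓡 n) ∞ M]
    [T2Space M] [SecondCountableTopology M] [MeasurableSpace M] [BorelSpace M]
    (g : LorentzianStructure n M) (hg : g.GloballyHyperbolic)
    {F₀ : Type*} [NormedAddCommGroup F₀] [NormedSpace ℂ F₀] [FiniteDimensional ℂ F₀]
    {V₀ : M → Type*} [∀ x, AddCommGroup (V₀ x)] [∀ x, Module ℂ (V₀ x)]
    [∀ x, TopologicalSpace (V₀ x)] [TopologicalSpace (TotalSpace F₀ V₀)] [FiberBundle F₀ V₀]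
    [VectorBundle ℂ F₀ V₀] [ContMDiffVectorBundle ∞ F₀ V₀ (𝓡 n)]
    {F₁ : Type*} [NormedAddCommGroup F₁] [NormedSpace ℂ F₁] [FiniteDimensional ℂ F₁]
    {V₁ : M → Type*} [∀ x, AddCommGroup (V₁ x)] [∀ x, Module ℂ (V₁ x)]
    [∀ x, TopologicalSpace (V₁ x)] [TopologicalSpace (TotalSpace F₁ V₁)] [FiberBundle F₁ V₁]
    [VectorBundle ℂ F₁ V₁] [ContMDiffVectorBundle ∞ F₁ V₁ (𝓡 n)]
    (h₀ : HermitianStructure n F₀ V₀) (h₁ : HermitianStructure n F₁ V₁)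
    (P : Sec n F₁ V₁ →ₗ[ℂ] Sec n F₁ V₁) (K T : Sec n F₀ V₀ →ₗ[ℂ] Sec n F₁ V₁)
    (hyp : HackSchenkel g h₀ h₁ P K T)
    (Kst : Sec n F₁ V₁ →ₗ[ℂ] Sec n F₀ V₀) (hKst : Kst = formalAdjoint g h₀ h₁ K)
    (D : Sec n F₁ V₁ →ₗ[ℂ] Sec n F₁ V₁) (hD : D = P + T ∘ₗ Kst) :
    InducesBijection (causalPropagator g D)
      (LinearMap.ker Kst ⊓ SecC n F₁ V₁) ((SecC n F₁ V₁).map P)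
      (LinearMap.ker P ⊓ SecSC F₁ V₁ g) ((SecSC F₀ V₀ g).map K) ∧
    InducesBijection (causalPropagator g D)
      (LinearMap.ker Kst ⊓ SecC n F₁ V₁) ((SecC n F₁ V₁).map P)
      (LinearMap.ker D ⊓ LinearMap.ker Kst ⊓ SecSC F₁ V₁ g)
      ((((SecC n F₀ V₀).map T).submoduleOf (SecC n F₁ V₁)).map (causalPropagator g D)) := by
  subst hKst hD
  have H := hyp.isGaugeFixed hg
  exact ⟨H.inducesBijection_ker_P hg, H.inducesBijection_ker_D hg⟩
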